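/- Let $\Lambda=(\lambda_n)_{n\ge 0}$ be a lacunary sequence, i.e. $\lambda_n>0$ for all $n$ and there is $r>1$ with $\lambda_{n+1}\ge r\lambda_n$ for every $n$. Let $m$ be Lebesgue measure on $[0,1]$ and let $M_\Lambda^2$ be the closed linear span of the monomials $t^{\lambda_n}$, $n\ge0$, in the complex space $L^2(m)$. A finite positive Borel measure $\mu$ on $[0,1)$ is called a Carleson measure for $M_\Lambda^2$ if there is a constant $C$ with $\|f\|_{L^2(\mu)}\le C\|f\|_{L^2(m)}$ for every finite linear combination $f$ of the $t^{\lambda_n}$; in this case $i_\mu^2:M_\Lambda^2\to L^2(\mu)$, $f\mapsto f$, denotes the corresponding bounded embedding (the unique bounded operator that maps each such $f$ to itself). For a bounded operator $S$ between Hilbert spaces and $n\ge1$ put $a_n(S)=\inf\{\|S-R\| : \operatorname{rank}R<n\}$, and for $q>0$ put $\|S\|_{\mathcal S^q}=\big(\sum_{n\ge1}a_n(S)^q\big)^{1/q}\in[0,\infty]$; $S$ belongs to the Schatten class $\mathcal S^q$ if it is compact and $\|S\|_{\mathcal S^q}<\infty$. Finally, for $n\ge 0$ let $$D_n(2)=\Big(\int_{[0,1)}\lambda_n^{1/2}t^{\lambda_n}\sum_{k\ge0}\lambda_k^{1/2}t^{\lambda_k}\,d\mu(t)\Big)^{1/2}\in[0,\infty],\qquad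 \|(D_n(2))_n\|_{\ell^q}=\Big(\sum_{n\ge0}D_n(2)^q\Big)^{1/q}\in[0,\infty].$$ **Theorem.** Let $\Lambda$ be a lacunary sequence and $q>0$. (i) There is a constant $C>0$ depending only on $q$ and $\Lambda$ such that for every finite positive Borel measure $\mu$ on $[0,1)$ with $(D_n(2))_n\in\ell^q$, the measure $\mu$ is a Carleson measure for $M_\Lambda^2$, the embedding $i_\mu^2$ belongs to $\mathcal S^q$, and $$\|i_\mu^2\|_{\mathcal S^q}\le C\,\|(D_n(2))_n\|_{\ell^q}.$$ (ii) If moreover $\Lambda$ is quasi-geometric, i.e. there are constants $1<r\le R<\infty$ with $r\le\lambda_{n+1}/\lambda_n\le R$ for every $n$, and $q\ge2$, then there are constants $c,C>0$ depending only on $q$ and $\Lambda$ such that for every finite positive Borel measure $\mu$ on $[0,1)$ that is a Carleson measure for $M_\Lambda^2$, $$c\,\|(D_n(2))_n\|_{\ell^q}\le\|i_\mu^2\|_{\mathcal S^q}\le C\,\|(D_n(2))_n\|_{\ell^q},$$ as an inequality between elements of $[0,\infty]$ (in particular, both quantities are finite or both are infinite). -/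

import Mathlib

open MeasureTheory
open scoped ENNReal NNReal

noncomputable section

namespace Muntz

/-- A sequence of positive numbers is lacunary if `u (n+1) ≥ r u n` for some fixed `r > 1`. -/
def IsLacunary (u : ℕ → ℝ) : Prop :=
  (∀ n, 0 < u n) ∧ ∃ r : ℝ, 1 < r ∧ ∀ n, r * u n ≤ u (n + 1)

/-- A sequence of positive numbers is quasi-geometric if its successive ratios lie in some
`[r, R]` with `1 < r ≤ R < ∞`. -/
def IsQuasiGeometric (u : ℕ → ℝ) : Prop :=
  (∀ n, 0 < u n) ∧ ∃ r R : ℝ, 1 < r ∧ ∀ n, r ≤ u (n + 1) / u n ∧ u (n + 1) / u n ≤ R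

/-- The half-open interval `[0,1)`. Since `{1}` is a Lebesgue null set, `L²([0,1], m)` is
`L²([0,1), m)`. -/
abbrev UnitIco : Type := Set.Ico (0 : ℝ) 1

/-- Lebesgue measure `m` on `[0,1)`. -/
abbrev lebesgue : Measure UnitIco := Measure.comap Subtype.val (volume : Measure ℝ)

/-- The function `t ↦ t ^ a` on `[0,1)`. -/
def monomial (a : ℝ) (t : UnitIco) : ℂ := (((t : ℝ) ^ a : ℝ) : ℂ)

theorem memLp_monomial (ν : Measure UnitIco) [IsFiniteMeasure ν] {a : ℝ} (ha : 0 ≤ a) :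
    MemLp (monomial a) 2 ν := by
  refine MemLp.of_bound (C := 1) ?_ (ae_of_all _ fun t => ?_)
  · refine Measurable.aestronglyMeasurable ?_
    exact Complex.measurable_ofReal.comp (measurable_subtype_coe.pow_const a)
  · rw [monomial, Complex.norm_real, Real.norm_of_nonneg (Real.rpow_nonneg t.2.1 a)]
    exact Real.rpow_le_one t.2.1 t.2.2.le ha

open scoped Classical in
/-- The class of `t ↦ t ^ a` in `L²(ν)`. The second branch is never used for finite `ν` and
`a ≥ 0`, by `memLp_monomial`. -/
def monomialLp (ν : Measure UnitIco) (a : ℝ) : Lp ℂ 2 ν :=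
  if h : MemLp (monomial a) 2 ν then h.toLp (monomial a) else 0

/-- The Müntz polynomial `∑ bₙ t ^ λₙ` (finitely many `bₙ ≠ 0`) as an element of `L²(ν)`. -/
def polynomialLp (Λ : ℕ → ℝ) (ν : Measure UnitIco) : (ℕ →₀ ℂ) →ₗ[ℂ] Lp ℂ 2 ν :=
  Finsupp.linearCombination ℂ (fun n => monomialLp ν (Λ n))

/-- The Müntz space `M_Λ²`: the closed linear span of the monomials `t ^ λₙ` in `L²(m)`. -/
def muntzSpace (Λ : ℕ → ℝ) : Submodule ℂ (Lp ℂ 2 lebesgue) :=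
  (LinearMap.range (polynomialLp Λ lebesgue)).topologicalClosure

/-- The Müntz polynomial with coefficients `b` as an element of `M_Λ²`. -/
def polynomialMuntz (Λ : ℕ → ℝ) : (ℕ →₀ ℂ) →ₗ[ℂ] muntzSpace Λ :=
  (polynomialLp Λ lebesgue).codRestrict (muntzSpace Λ) fun b =>
    Submodule.le_topologicalClosure _ (LinearMap.mem_range_self _ b)

/-- `μ` is a Carleson measure for `M_Λ²`: `‖f‖_{L²(μ)} ≤ C ‖f‖_{L²(m)}` for every Müntz
polynomial `f`. -/
def IsCarleson (Λ : ℕ → ℝ) (μ : Measure UnitIco) : Prop :=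
  ∃ C : ℝ, ∀ b : ℕ →₀ ℂ, ‖polynomialLp Λ μ b‖ ≤ C * ‖polynomialLp Λ lebesgue b‖

/-- The Carleson embedding `i_μ² : M_Λ² → L²(μ)`, `f ↦ f`: when `μ` is a Carleson measure, it is
the unique bounded operator sending each Müntz polynomial `f` to itself (Müntz polynomials being
dense in `M_Λ²`). -/
def carlesonEmbedding (Λ : ℕ → ℝ) (μ : Measure UnitIco) : muntzSpace Λ →L[ℂ] Lp ℂ 2 μ :=
  (polynomialLp Λ μ).extendOfNorm (polynomialMuntz Λ)

theorem denseRange_polynomialMuntz (Λ : ℕ → ℝ) : DenseRange (polynomialMuntz Λ) := by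
  intro x
  rw [Metric.mem_closure_iff]
  intro ε hε
  obtain ⟨y, ⟨b, rfl⟩, hy⟩ := Metric.mem_closure_iff.1 x.2 ε hε
  exact ⟨polynomialMuntz Λ b, ⟨b, rfl⟩, hy⟩

theorem carlesonEmbedding_polynomial {Λ : ℕ → ℝ} {μ : Measure UnitIco} (h : IsCarleson Λ μ)
    (b : ℕ →₀ ℂ) : carlesonEmbedding Λ μ (polynomialMuntz Λ b) = polynomialLp Λ μ b :=
  LinearMap.extendOfNorm_eq (denseRange_polynomialMuntz Λ) h b

section Schatten

variable {X Y : Type*} [NormedAddCommGroup X] [NormedSpace ℂ X]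
  [NormedAddCommGroup Y] [NormedSpace ℂ Y]

/-- The approximation numbers `aₙ(S) = inf {‖S - R‖ : rank R < n}`, for `n ≥ 1`. -/
def approxNumber (S : X →L[ℂ] Y) (n : ℕ) : ℝ≥0∞ :=
  ⨅ (R : X →L[ℂ] Y) (_ : (R : X →ₗ[ℂ] Y).rank < (n : Cardinal)), ‖S - R‖ₑ

/-- The Schatten norm `(∑_{n ≥ 1} aₙ(S) ^ q) ^ (1/q)`, with value in `[0, ∞]`. -/
def schattenNorm (q : ℝ) (S : X →L[ℂ] Y) : ℝ≥0∞ :=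
  (∑' n : ℕ, approxNumber S (n + 1) ^ q) ^ (1 / q)

/-- Membership in the Schatten class `S^q`. -/
def MemSchatten (q : ℝ) (S : X →L[ℂ] Y) : Prop :=
  IsCompactOperator S ∧ ∑' n : ℕ, approxNumber S (n + 1) ^ q < ∞

end Schatten

/-- `D_n(p) = (∫ λₙ^{1/p} t^{λₙ} (∑ₖ λₖ^{1/p} t^{λₖ})^{p-1} dμ)^{1/p}`, with value in `[0, ∞]`. -/
def D (Λ : ℕ → ℝ) (μ : Measure UnitIco) (p : ℝ) (n : ℕ) : ℝ≥0∞ :=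
  (∫⁻ t : UnitIco, ENNReal.ofReal (Λ n ^ (1 / p) * (t : ℝ) ^ Λ n) *
    (∑' k : ℕ, ENNReal.ofReal (Λ k ^ (1 / p) * (t : ℝ) ^ Λ k)) ^ (p - 1) ∂μ) ^ (1 / p)

/-- The `ℓ^q` (quasi-)norm of a sequence with values in `[0, ∞]`. -/
def ellNorm (q : ℝ) (u : ℕ → ℝ≥0∞) : ℝ≥0∞ := (∑' n : ℕ, u n ^ q) ^ (1 / q)

end Muntz

end

open MeasureTheory
open scoped ENNReal NNReal

noncomputable section

namespace Muntz

/-! For lacunary `Λ` the functions `√λₙ t^λₙ` form a Riesz sequence in `L²(m)`. The upper estimate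
is Schur's test on an exponentially decaying Gram matrix (`exists_riesz_upper`). For the lower one,
the Gram matrix of the monomials is the Cauchy matrix with nodes `λₙ + 1/2`, whose explicit inverse
is controlled by uniformly bounded products (`exists_riesz_lower`).

Weighted Cauchy–Schwarz bounds `‖∑ bₙ t^λₙ‖²` in `L²(μ)` by `∑ (|bₙ|²/λₙ) Dₙ²`
(`enorm_sum_monomialLp_sq_le`). Hence the embedding is dominated by a diagonal operator with entries
`Dₙ`: discarding the coefficients in a finite set `F` costs rank at most `|F|` and leaves norm at
most `C sup_{n ∉ F} Dₙ`. Choosing `F` greedily gives the upper bound for every `q > 0`.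

For the lower bound with `q ≥ 2`, Jensen's inequality in a singular basis bounds `∑ ‖S gₙ‖^q` by the
approximation numbers of `S` for a Bessel sequence `gₙ` (`sum_enorm_rpow_le_tsum_approxNumber`). If
the ratios of `Λ` are also bounded above, `Dₙ²` is at most an exponentially weighted sum of the
`‖g_j‖²` in `L²(μ)` (`exists_D_two_sq_le`), and such weights act boundedly on `ℓ^{q/2}`
(`exists_tsum_rpow_le`). -/

/-! ### Off-diagonal decay and Schur's test. -/

theorem sum_pow_dist_le {ρ : ℝ} (h0 : 0 ≤ ρ) (h1 : ρ < 1) (n : ℕ) (s : Finset ℕ) :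
    ∑ k ∈ s, ρ ^ (Nat.dist n k) ≤ 2 / (1 - ρ) := by
  have hg : ∀ M : ℕ, ∑ j ∈ Finset.range M, ρ ^ j ≤ 1 / (1 - ρ) := fun M => by
    rw [one_div, ← tsum_geometric_of_lt_one h0 h1]
    exact (summable_geometric_of_lt_one h0 h1).sum_le_tsum _ fun _ _ => by positivity
  obtain ⟨M, hM⟩ := s.exists_nat_subset_range
  have hsub : s ⊆ Finset.range (n + 1 + M) := hM.trans (Finset.range_mono (by omega))
  calc ∑ k ∈ s, ρ ^ (Nat.dist n k) ≤ ∑ k ∈ Finset.range (n + 1 + M), ρ ^ (Nat.dist n k) :=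
        Finset.sum_le_sum_of_subset_of_nonneg hsub fun _ _ _ => by positivity
    _ = ∑ k ∈ Finset.range (n + 1), ρ ^ k + ∑ j ∈ Finset.range M, ρ ^ (j + 1) := by
        rw [Finset.sum_range_add, ← Finset.sum_range_reflect]
        congr 1
        · refine Finset.sum_congr rfl fun k hk => ?_
          have := Finset.mem_range.1 hk
          congr 1
          simp only [Nat.dist]; omega
        · refine Finset.sum_congr rfl fun k hk => ?_
          congr 1
          simp only [Nat.dist]; omega
    _ ≤ ∑ k ∈ Finset.range (n + 1), ρ ^ k + ∑ j ∈ Finset.range M, ρ ^ j := by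
        exact add_le_add le_rfl (Finset.sum_le_sum fun j _ =>
          pow_le_pow_of_le_one h0 h1.le (Nat.le_succ j))
    _ ≤ 2 / (1 - ρ) := by
        have := add_le_add (hg (n + 1)) (hg M)
        rwa [← add_div, one_add_one_eq_two] at this

theorem exists_decay {u : ℕ → ℝ} (hu : IsLacunary u) :
    ∃ σ : ℝ, 0 < σ ∧ σ < 1 ∧ ∀ n k, k ≤ n → u k ≤ (σ ^ (n - k)) ^ 2 * u n := by
  obtain ⟨-, r, hr, hur⟩ := hu
  have hr0 : 0 < r := by linarith
  -- The square root is taken so that geometric means `√(uₙ uₖ)` decay like `σ` to the power `|n -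
  -- k|`.
  refine ⟨√r⁻¹, by positivity, ?_, fun n k hk => ?_⟩
  · rw [Real.sqrt_lt' one_pos, one_pow]
    exact inv_lt_one_of_one_lt₀ hr
  · rw [← pow_mul, mul_comm (n - k), pow_mul, Real.sq_sqrt (by positivity)]
    induction n, hk using Nat.le_induction with
    | base => simp
    | succ m hm ih =>
      rw [Nat.succ_sub hm, pow_succ, mul_assoc]
      refine ih.trans ?_
      gcongr
      rw [inv_mul_eq_div, le_div_iff₀ hr0, mul_comm]
      exact hur m

theorem sqrt_mul_le_pow_dist {u : ℕ → ℝ} (hpos : ∀ n, 0 < u n) {σ : ℝ} (hσ : 0 < σ)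
    (h : ∀ n k, k ≤ n → u k ≤ (σ ^ (n - k)) ^ 2 * u n) (n k : ℕ) :
    √(u n * u k) ≤ σ ^ (Nat.dist n k) * u (max n k) := by
  wlog hk : k ≤ n generalizing n k with H
  · rw [mul_comm, Nat.dist_comm, max_comm]
    exact H k n (le_of_not_ge hk)
  rw [max_eq_left hk, Nat.dist_eq_sub_of_le_right hk]
  have := hpos n
  refine Real.sqrt_le_iff.2 ⟨by positivity, ?_⟩
  calc u n * u k ≤ u n * ((σ ^ (n - k)) ^ 2 * u n) := by gcongr; exact h n k hk
    _ = _ := by ring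

/-- The Gram matrix `√(uₙ uₖ) / (uₙ + uₖ)` of a lacunary sequence decays off the diagonal. -/
theorem sqrt_mul_div_add_le {u : ℕ → ℝ} (hpos : ∀ n, 0 < u n) {σ : ℝ} (hσ : 0 < σ)
    (h : ∀ n k, k ≤ n → u k ≤ (σ ^ (n - k)) ^ 2 * u n) (n k : ℕ) :
    √(u n * u k) / (u n + u k) ≤ σ ^ (Nat.dist n k) := by
  have h1 := hpos n
  have h2 := hpos k
  rw [div_le_iff₀ (by positivity)]
  refine (sqrt_mul_le_pow_dist hpos hσ h n k).trans ?_
  gcongr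
  rcases max_choice n k with h | h <;> rw [h] <;> linarith

/-- Schur's test: with `xⱼ = aⱼ/√vⱼ` the summand is `xⱼ xₖ wⱼₖ` for a symmetric kernel `w`; apply
`2xⱼxₖ ≤ xⱼ² + xₖ²` and the row sums of `w`. -/
theorem sum_sum_mul_div_add_le {ι : Type*} {s : Finset ι} {v a : ι → ℝ} (hv : ∀ i, 0 < v i)
    {A : ℝ} (hA : ∀ j ∈ s, ∑ k ∈ s, √(v j * v k) / (v j + v k) ≤ A) :
    ∑ j ∈ s, ∑ k ∈ s, a j * a k / (v j + v k) ≤ A * ∑ j ∈ s, a j ^ 2 / v j := by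
  set w : ι → ι → ℝ := fun j k => √(v j * v k) / (v j + v k) with hw
  have hwsymm : ∀ j k, w j k = w k j := fun j k => by
    simp only [hw]; rw [mul_comm, add_comm]
  have hterm : ∀ j k, a j * a k / (v j + v k) ≤
      (a j ^ 2 / v j) * w j k / 2 + (a k ^ 2 / v k) * w k j / 2 := by
    intro j k
    have h1 := hv j
    have h2 := hv k
    have e : a j * a k / (v j + v k) = (a j / √(v j)) * (a k / √(v k)) * w j k := by
      simp only [hw]
      rw [Real.sqrt_mul h1.le]
      have := Real.sqrt_pos.2 h1
      have := Real.sqrt_pos.2 h2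
      field_simp
    have hx : a j ^ 2 / v j = (a j / √(v j)) ^ 2 := by rw [div_pow, Real.sq_sqrt h1.le]
    have hy : a k ^ 2 / v k = (a k / √(v k)) ^ 2 := by rw [div_pow, Real.sq_sqrt h2.le]
    rw [e, hx, hy, hwsymm k j, ← add_div, ← add_mul]
    have hw0 : 0 ≤ w j k := by simp only [hw]; positivity
    nlinarith [mul_nonneg hw0 (sq_nonneg (a j / √(v j) - a k / √(v k)))]
  calc ∑ j ∈ s, ∑ k ∈ s, a j * a k / (v j + v k)
      ≤ ∑ j ∈ s, ∑ k ∈ s, ((a j ^ 2 / v j) * w j k / 2 + (a k ^ 2 / v k) * w k j / 2) :=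
        Finset.sum_le_sum fun j _ => Finset.sum_le_sum fun k _ => hterm j k
    _ = ∑ j ∈ s, ∑ k ∈ s, (a j ^ 2 / v j) * w j k := by
        simp only [Finset.sum_add_distrib]
        rw [Finset.sum_comm (f := fun j k => a k ^ 2 / v k * w k j / 2), ← Finset.sum_add_distrib]
        refine Finset.sum_congr rfl fun j _ => ?_
        rw [← Finset.sum_add_distrib]
        exact Finset.sum_congr rfl fun k _ => by ring
    _ ≤ ∑ j ∈ s, (a j ^ 2 / v j) * A := by
        refine Finset.sum_le_sum fun j hj => ?_
        rw [← Finset.mul_sum]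
        have := hv j
        gcongr
        exact hA j hj
    _ = A * ∑ j ∈ s, a j ^ 2 / v j := by rw [← Finset.sum_mul, mul_comm]

/-! ### Inversion of Cauchy matrices. -/

section Cauchy

variable {ι : Type*} [DecidableEq ι]

/-- The weights occurring in the inverse of the Cauchy matrix `1 / (vᵢ + vⱼ)`. -/
def cauchyWeight (s : Finset ι) (v : ι → ℝ) (k : ι) : ℝ :=
  2 * v k * ∏ l ∈ s.erase k, (v k + v l) / (v k - v l)

theorem cauchyWeight_ne_zero {s : Finset ι} {v : ι → ℝ} (hv : ∀ i, 0 < v i)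
    (hinj : Function.Injective v) (k : ι) : cauchyWeight s v k ≠ 0 := by
  refine mul_ne_zero (mul_ne_zero two_ne_zero (hv k).ne') (Finset.prod_ne_zero_iff.2 fun l hl => ?_)
  exact div_ne_zero (add_pos (hv k) (hv l)).ne'
    (sub_ne_zero.2 fun h => (Finset.ne_of_mem_erase hl) (hinj h).symm)

-- In matrix form, `M diag(b) M = diag(b)⁻¹` for the Cauchy matrix `M`, hence `M⁻¹ = diag(b) M
-- diag(b)`. It comes from Lagrange interpolation at the nodes `vₖ` of `∏_{l ≠ i} (X + v_l)`,
-- evaluated at `-vⱼ`, where this polynomial vanishes unless `i = j`.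
open Polynomial in
theorem sum_cauchyWeight {s : Finset ι} {v : ι → ℝ} (hv : ∀ i, 0 < v i)
    (hinj : Function.Injective v) {i j : ι} (hi : i ∈ s) (hj : j ∈ s) :
    ∑ k ∈ s, cauchyWeight s v k / ((v k + v i) * (v k + v j)) =
      if i = j then (cauchyWeight s v i)⁻¹ else 0 := by
  have hne : ∀ k l, v k + v l ≠ 0 := fun k l => (add_pos (hv k) (hv l)).ne'
  set P : ℝ[X] := ∏ l ∈ s.erase i, (X + C (v l)) with hP
  have hPe : ∀ x, P.eval x = ∏ l ∈ s.erase i, (x + v l) := fun x => by simp [hP, eval_prod]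
  have hdeg : P.degree < s.card := by
    have : P = Lagrange.nodal (s.erase i) (fun l => - v l) := by
      simp [hP, Lagrange.nodal]
    rw [this, Lagrange.degree_nodal]
    exact_mod_cast Finset.card_erase_lt_of_mem hi
  have key := Lagrange.eval_interpolate_not_at_node (s := s) (v := v) (r := fun k => P.eval (v k))
    (x := - v j) (fun k _ => by have := hv k; have := hv j; intro h; linarith)
  rw [← Lagrange.eq_interpolate hinj.injOn hdeg, Lagrange.eval_nodal] at key
  have hterm : ∀ k ∈ s, Lagrange.nodalWeight s v k * (-v j - v k)⁻¹ * P.eval (v k) =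
      - (cauchyWeight s v k / ((v k + v i) * (v k + v j))) := by
    intro k hk
    have h1 : P.eval (v k) * (v k + v i) = 2 * v k * ∏ l ∈ s.erase k, (v k + v l) := by
      rw [hPe, mul_comm, Finset.mul_prod_erase s (fun l => v k + v l) hi,
        ← Finset.mul_prod_erase s (fun l => v k + v l) hk, two_mul]
    have h2 : P.eval (v k) = 2 * v k * (∏ l ∈ s.erase k, (v k + v l)) / (v k + v i) := by
      rw [eq_div_iff (hne k i), h1]
    have h3 : (-v j - v k)⁻¹ = - (v k + v j)⁻¹ := by rw [← inv_neg]; congr 1; ring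
    rw [h2, h3, Lagrange.nodalWeight, cauchyWeight, Finset.prod_div_distrib,
      Finset.prod_inv_distrib]
    simp only [div_eq_mul_inv, mul_inv]
    ring
  rw [Finset.sum_congr rfl hterm, Finset.sum_neg_distrib, hPe] at key
  have hnod : ∏ l ∈ s, (-v j - v l) ≠ 0 := Finset.prod_ne_zero_iff.2 fun l _ h =>
    hne j l (by linarith)
  split_ifs with hij
  · subst hij
    have h4 : ∏ l ∈ s, (-v i - v l) =
        - (2 * v i) * ((-1) ^ (s.erase i).card * ∏ l ∈ s.erase i, (v i + v l)) := by
      rw [← Finset.mul_prod_erase s _ hi, ← Finset.prod_neg]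
      congr 1
      · ring
      · exact Finset.prod_congr rfl fun l _ => by ring
    have h5 : ∏ l ∈ s.erase i, (-v i + v l) =
        (-1) ^ (s.erase i).card * ∏ l ∈ s.erase i, (v i - v l) := by
      rw [← Finset.prod_neg]
      exact Finset.prod_congr rfl fun l _ => by ring
    rw [h4, h5] at key
    have hu : ((-1 : ℝ)) ^ (s.erase i).card ≠ 0 := by positivity
    have ha : ∏ l ∈ s.erase i, (v i + v l) ≠ 0 := Finset.prod_ne_zero_iff.2 fun l _ => hne i l
    have hw := cauchyWeight_ne_zero (s := s) hv hinj i
    have hvi := (hv i).ne'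
    rw [cauchyWeight, Finset.prod_div_distrib] at hw ⊢
    have hb : ∏ l ∈ s.erase i, (v i - v l) ≠ 0 := fun h => hw (by rw [h]; simp)
    generalize (∑ k ∈ s, _ : ℝ) = S at key ⊢
    have key2 : ∏ l ∈ s.erase i, (v i - v l) = 2 * v i * (∏ l ∈ s.erase i, (v i + v l)) * S := by
      apply mul_left_cancel₀ hu
      rw [key]; ring
    field_simp
    linarith
  · have h0 : ∏ l ∈ s.erase i, (-v j + v l) = 0 :=
      Finset.prod_eq_zero (Finset.mem_erase.2 ⟨fun h => hij h.symm, hj⟩) (by ring)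
    rw [h0] at key
    rcases mul_eq_zero.1 key.symm with h | h
    · exact absurd h hnod
    · exact neg_eq_zero.1 h

/-- The linear system with a Cauchy matrix has a solution with an explicit energy bound. -/
theorem exists_cauchy_solution {s : Finset ι} {v : ι → ℝ} (hv : ∀ i, 0 < v i)
    (hinj : Function.Injective v) {A B : ℝ}
    (hA : ∀ j ∈ s, ∑ k ∈ s, √(v j * v k) / (v j + v k) ≤ A)
    (hB : ∀ k ∈ s, |∏ l ∈ s.erase k, (v k + v l) / (v k - v l)| ≤ B) (c : ι → ℂ) :
    ∃ y : ι → ℂ, (∀ j ∈ s, ∑ k ∈ s, y k / ((v k + v j : ℝ) : ℂ) = c j / (v j : ℂ)) ∧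
      ‖∑ j ∈ s, (starRingEnd ℂ) (y j) * (c j / (v j : ℂ))‖ ≤
        4 * B ^ 2 * A * ∑ j ∈ s, ‖c j‖ ^ 2 / v j := by
  set b := cauchyWeight s v with hb
  have hne : ∀ k l, ((v k + v l : ℝ) : ℂ) ≠ 0 := fun k l =>
    Complex.ofReal_ne_zero.2 (add_pos (hv k) (hv l)).ne'
  -- The explicit inverse `diag(b) M diag(b)` applied to the vector `c/v`.
  refine ⟨fun k => b k * ∑ i ∈ s, b i * (c i / (v i : ℂ)) / ((v k + v i : ℝ) : ℂ), ?_, ?_⟩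
  · intro j hj
    calc ∑ k ∈ s, (b k * ∑ i ∈ s, b i * (c i / (v i : ℂ)) / ((v k + v i : ℝ) : ℂ)) /
            ((v k + v j : ℝ) : ℂ)
        = ∑ k ∈ s, ∑ i ∈ s, b i * (c i / (v i : ℂ)) *
            ((b k / ((v k + v i) * (v k + v j)) : ℝ) : ℂ) := by
          refine Finset.sum_congr rfl fun k _ => ?_
          rw [Finset.mul_sum, Finset.sum_div]
          refine Finset.sum_congr rfl fun i _ => ?_
          rw [Complex.ofReal_div, Complex.ofReal_mul]
          have := hne k i
          have := hne k j
          field_simp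
      _ = ∑ i ∈ s, b i * (c i / (v i : ℂ)) *
            ((if i = j then (b i)⁻¹ else 0 : ℝ) : ℂ) := by
          rw [Finset.sum_comm]
          refine Finset.sum_congr rfl fun i hi => ?_
          rw [← Finset.mul_sum, ← Complex.ofReal_sum, sum_cauchyWeight hv hinj hi hj]
      _ = c j / (v j : ℂ) := by
          rw [Finset.sum_eq_single_of_mem j hj fun i _ hij => by simp [hij]]
          have : (b j : ℂ) ≠ 0 := Complex.ofReal_ne_zero.2 (cauchyWeight_ne_zero hv hinj j)
          simp only [if_true, Complex.ofReal_inv]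
          field_simp
  · have hbv : ∀ k ∈ s, |b k| / v k ≤ 2 * B := fun k hk => by
      have h1 := hv k
      rw [div_le_iff₀ h1, hb, cauchyWeight, abs_mul, abs_of_pos (by positivity)]
      nlinarith [hB k hk]
    have hterm : ∀ j ∈ s, ∀ k ∈ s,
        |b j| * (|b k| * (‖c k‖ / v k) / (v j + v k)) * (‖c j‖ / v j) ≤
          4 * B ^ 2 * (‖c j‖ * ‖c k‖ / (v j + v k)) := by
      intro j hj k hk
      have h1 := hv j
      have h2 := hv k
      have : |b j| * (|b k| * (‖c k‖ / v k) / (v j + v k)) * (‖c j‖ / v j) =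
          (|b j| / v j) * (|b k| / v k) * (‖c j‖ * ‖c k‖ / (v j + v k)) := by ring
      rw [this]
      have h3 : (|b j| / v j) * (|b k| / v k) ≤ (2 * B) * (2 * B) :=
        mul_le_mul (hbv j hj) (hbv k hk) (by positivity)
          (le_trans (by positivity) (hbv j hj))
      calc _ ≤ (2 * B) * (2 * B) * (‖c j‖ * ‖c k‖ / (v j + v k)) := by gcongr
        _ = _ := by ring
    calc _ ≤ ∑ j ∈ s, ∑ k ∈ s,
          |b j| * (|b k| * (‖c k‖ / v k) / (v j + v k)) * (‖c j‖ / v j) := by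
          refine (norm_sum_le _ _).trans (Finset.sum_le_sum fun j _ => ?_)
          have h1 := hv j
          rw [norm_mul, RCLike.norm_conj, norm_mul, norm_div, Complex.norm_real, Complex.norm_real,
            Real.norm_eq_abs, Real.norm_of_nonneg h1.le, ← Finset.sum_mul, ← Finset.mul_sum]
          gcongr
          refine (norm_sum_le _ _).trans (Finset.sum_le_sum fun k _ => ?_)
          have h2 := hv k
          rw [norm_div, norm_mul, norm_div, Complex.norm_real, Complex.norm_real, Complex.norm_real,
            Real.norm_eq_abs, Real.norm_of_nonneg h2.le, Real.norm_of_nonneg (by positivity)]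
      _ ≤ ∑ j ∈ s, ∑ k ∈ s, 4 * B ^ 2 * (‖c j‖ * ‖c k‖ / (v j + v k)) :=
          Finset.sum_le_sum fun j hj => Finset.sum_le_sum fun k hk => hterm j hj k hk
      _ = 4 * B ^ 2 * ∑ j ∈ s, ∑ k ∈ s, ‖c j‖ * ‖c k‖ / (v j + v k) := by
          simp only [Finset.mul_sum]
      _ ≤ 4 * B ^ 2 * (A * ∑ j ∈ s, ‖c j‖ ^ 2 / v j) := by
          gcongr
          exact sum_sum_mul_div_add_le hv hA
      _ = _ := by ring

end Cauchy

/-- Each factor differs from `1` in absolute value by a constant times `σ^|k-l|`; passing to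
exponentials turns the product into a geometric sum, bounded independently of `s` and `k`. -/
theorem abs_prod_div_le {u : ℕ → ℝ} (hpos : ∀ n, 0 < u n) {σ : ℝ} (hσ : 0 < σ) (hσ1 : σ < 1)
    (h : ∀ n k, k ≤ n → u k ≤ (σ ^ (n - k)) ^ 2 * u n) (s : Finset ℕ) (k : ℕ) :
    |∏ l ∈ s.erase k, (u k + u l) / (u k - u l)| ≤ Real.exp (2 / (1 - σ) * (2 / (1 - σ))) := by
  have hσ' : 0 < 1 - σ := by linarith
  have aux : ∀ m n, m < n → (u n + u m) / (u n - u m) ≤ Real.exp (2 / (1 - σ) * σ ^ (n - m)) := by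
    intro m n hmn
    have hn := hpos n
    have hm := hpos m
    set x := σ ^ (n - m) with hx
    have hx0 : 0 < x := by positivity
    have hx1 : x ≤ σ := by
      simpa using pow_le_pow_of_le_one hσ.le hσ1.le (show 1 ≤ n - m by omega)
    have h1 : u m ≤ x * u n := by
      refine (h n m hmn.le).trans ?_
      rw [← hx]
      gcongr
      nlinarith
    have h2 : (1 - σ) * u n ≤ u n - u m := by nlinarith
    have h3 : 0 < u n - u m := lt_of_lt_of_le (by positivity) h2
    calc (u n + u m) / (u n - u m) = 2 * u m / (u n - u m) + 1 := by field_simp; ring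
      _ ≤ 2 * (x * u n) / ((1 - σ) * u n) + 1 := by gcongr
      _ = 2 / (1 - σ) * x + 1 := by field_simp
      _ ≤ _ := Real.add_one_le_exp _
  have hterm : ∀ l ∈ s.erase k,
      |(u k + u l) / (u k - u l)| ≤ Real.exp (2 / (1 - σ) * σ ^ (Nat.dist k l)) := by
    intro l hl
    have hk := hpos k
    have hl' := hpos l
    have hlt : ∀ m n, m < n → u m < u n := fun m n hmn => by
      refine (h n m hmn.le).trans_lt ?_
      have : (σ ^ (n - m)) ^ 2 < 1 := by
        rw [← pow_mul]
        exact pow_lt_one₀ hσ.le hσ1 (by omega)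
      nlinarith [hpos n]
    rcases lt_or_gt_of_ne (Finset.ne_of_mem_erase hl) with hlk | hlk
    · have := hlt l k hlk
      rw [abs_of_pos (div_pos (by positivity) (by linarith)), Nat.dist_eq_sub_of_le_right hlk.le]
      exact aux l k hlk
    · have := hlt k l hlk
      rw [abs_div, abs_of_pos (by positivity : 0 < u k + u l), abs_of_neg (by linarith),
        Nat.dist_eq_sub_of_le hlk.le, neg_sub, add_comm]
      exact aux k l hlk
  rw [Finset.abs_prod]
  calc _ ≤ ∏ l ∈ s.erase k, Real.exp (2 / (1 - σ) * σ ^ (Nat.dist k l)) :=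
        Finset.prod_le_prod (fun _ _ => abs_nonneg _) hterm
    _ = Real.exp (2 / (1 - σ) * ∑ l ∈ s.erase k, σ ^ (Nat.dist k l)) := by
        rw [← Real.exp_sum, Finset.mul_sum]
    _ ≤ _ := by
        gcongr
        exact sum_pow_dist_le hσ.le hσ1 k _

/-! ### Monomials in `L²` and Riesz estimates. -/

theorem coeFn_monomialLp (ν : Measure UnitIco) [IsFiniteMeasure ν] {a : ℝ} (ha : 0 ≤ a) :
    monomialLp ν a =ᵐ[ν] monomial a := by
  rw [monomialLp, dif_pos (memLp_monomial ν ha)]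
  exact MemLp.coeFn_toLp _

theorem inner_monomialLp (ν : Measure UnitIco) [IsFiniteMeasure ν] {a b : ℝ} (ha : 0 ≤ a)
    (hb : 0 ≤ b) :
    inner ℂ (monomialLp ν a) (monomialLp ν b) = ((∫ t, (t : ℝ) ^ (a + b) ∂ν : ℝ) : ℂ) := by
  rw [L2.inner_def, ← integral_complex_ofReal]
  refine integral_congr_ae ?_
  filter_upwards [coeFn_monomialLp ν ha, coeFn_monomialLp ν hb] with t h1 h2
  rw [h1, h2, RCLike.inner_apply, monomial, monomial, Complex.conj_ofReal, ← Complex.ofReal_mul,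
    Real.rpow_add_of_nonneg t.2.1 ha hb, mul_comm]

instance isFiniteMeasure_lebesgue : IsFiniteMeasure lebesgue := by
  refine ⟨?_⟩
  rw [lebesgue, Measure.comap_apply _ Subtype.val_injective
    (fun s hs => (measurableSet_Ico : MeasurableSet (Set.Ico (0 : ℝ) 1)).subtype_image hs) _
    MeasurableSet.univ, Set.image_univ, Subtype.range_coe]
  exact measure_Ico_lt_top

theorem integral_rpow_lebesgue {a : ℝ} (ha : 0 ≤ a) :
    ∫ t, (t : ℝ) ^ a ∂lebesgue = 1 / (a + 1) := by
  rw [lebesgue, integral_subtype_comap (measurableSet_Ico : MeasurableSet (Set.Ico (0 : ℝ) 1))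
    (fun t : ℝ => t ^ a), integral_Ico_eq_integral_Ioo, ← integral_Ioc_eq_integral_Ioo,
    ← intervalIntegral.integral_of_le zero_le_one, integral_rpow (Or.inl (by linarith))]
  rw [Real.one_rpow, Real.zero_rpow (by linarith), sub_zero]

/-- Splitting `a + b + 1` symmetrically exhibits the Gram matrix as a Cauchy matrix with shifted
nodes. -/
theorem inner_monomialLp_lebesgue {a b : ℝ} (ha : 0 ≤ a) (hb : 0 ≤ b) :
    inner ℂ (monomialLp lebesgue a) (monomialLp lebesgue b) =
      1 / (((a + 1 / 2) + (b + 1 / 2) : ℝ) : ℂ) := by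
  rw [inner_monomialLp lebesgue ha hb, integral_rpow_lebesgue (add_nonneg ha hb)]
  push_cast
  congr 1
  ring

theorem polynomialLp_eq_sum (Λ : ℕ → ℝ) (ν : Measure UnitIco) (b : ℕ →₀ ℂ) :
    polynomialLp Λ ν b = ∑ n ∈ b.support, b n • monomialLp ν (Λ n) :=
  Finsupp.linearCombination_apply ℂ b

theorem IsLacunary.monotone {u : ℕ → ℝ} (hu : IsLacunary u) : Monotone u := by
  obtain ⟨hpos, r, hr, h⟩ := hu
  refine monotone_nat_of_le_succ fun n => ?_
  nlinarith [hpos n, h n]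

theorem IsLacunary.strictMono {u : ℕ → ℝ} (hu : IsLacunary u) : StrictMono u := by
  obtain ⟨hpos, r, hr, h⟩ := hu
  refine strictMono_nat_of_lt_succ fun n => ?_
  nlinarith [hpos n, h n]

theorem IsLacunary.add_half {u : ℕ → ℝ} (hu : IsLacunary u) :
    IsLacunary (fun n => u n + 1 / 2) := by
  have hmono := hu.monotone
  obtain ⟨hpos, r, hr, h⟩ := hu
  have h0 := hpos 0
  refine ⟨fun n => by have := hpos n; positivity, 1 + (r - 1) * (u 0 / (u 0 + 1 / 2)), ?_,
    fun n => ?_⟩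
  · have : 0 < (r - 1) * (u 0 / (u 0 + 1 / 2)) := mul_pos (by linarith) (by positivity)
    linarith
  · have hn := hmono (Nat.zero_le n)
    -- The shift matters most at `n = 0`, since `x/(x + 1/2)` is increasing; this fixes the new
    -- ratio.
    have h1 : u 0 / (u 0 + 1 / 2) * (u n + 1 / 2) ≤ u n := by
      rw [div_mul_eq_mul_div, div_le_iff₀ (by positivity)]
      nlinarith
    nlinarith [h n, mul_le_mul_of_nonneg_left h1 (by linarith : 0 ≤ r - 1)]

/-- The normalized monomials of a lacunary sequence satisfy a lower Riesz estimate in `L²(m)`. -/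
theorem exists_riesz_lower {Λ : ℕ → ℝ} (hΛ : IsLacunary Λ) :
    ∃ C : ℝ, 0 < C ∧ ∀ b : ℕ →₀ ℂ,
      ∑ n ∈ b.support, ‖b n‖ ^ 2 / Λ n ≤ C ^ 2 * ‖polynomialLp Λ lebesgue b‖ ^ 2 := by
  set v : ℕ → ℝ := fun n => Λ n + 1 / 2 with hvdef
  have hv : IsLacunary v := hΛ.add_half
  have hpos := hΛ.1
  have hvpos := hv.1
  obtain ⟨σ, hσ0, hσ1, hσ⟩ := exists_decay hv
  have hσ' : 0 < 1 - σ := by linarith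
  set A : ℝ := 2 / (1 - σ) with hA
  set B : ℝ := Real.exp (2 / (1 - σ) * (2 / (1 - σ))) with hB
  have hApos : 0 < A := by positivity
  have hBpos : 0 < B := Real.exp_pos _
  -- `K` is the price of replacing the shifted weights `vₙ` by `Λₙ`.
  set K : ℝ := 1 + 1 / (2 * Λ 0) with hK
  have hKpos : 0 < K := by have := hpos 0; positivity
  refine ⟨√(K * (4 * B ^ 2 * A)), by positivity, fun b => ?_⟩
  rw [Real.sq_sqrt (by positivity)]
  set s := b.support
  set E : ℝ := ∑ n ∈ s, ‖b n‖ ^ 2 / v n with hE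
  have hE0 : 0 ≤ E := Finset.sum_nonneg fun n _ => by have := hvpos n; positivity
  have hcomp : ∑ n ∈ s, ‖b n‖ ^ 2 / Λ n ≤ K * E := by
    rw [hE, Finset.mul_sum]
    refine Finset.sum_le_sum fun n _ => ?_
    have h0 := hpos 0
    have hn := hpos n
    have hvn := hvpos n
    have h1 : v n ≤ K * Λ n := by
      have : 1 / 2 ≤ 1 / (2 * Λ 0) * Λ n := by
        rw [div_mul_eq_mul_div, one_mul, div_le_div_iff₀ (by positivity) (by positivity)]
        linarith [hΛ.monotone (Nat.zero_le n)]
      simp only [hvdef, hK]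
      linarith
    rw [← mul_div_assoc, div_le_div_iff₀ hn hvn]
    nlinarith [sq_nonneg ‖b n‖, mul_le_mul_of_nonneg_left h1 (sq_nonneg ‖b n‖)]
  -- Duality: `y` gives the `g` in the span with `⟨t^λⱼ, g⟩ = bⱼ/vⱼ`, so that `⟨f, g⟩ = E` while
  -- `‖g‖²` is at most a constant times `E`. Cauchy–Schwarz then bounds `E` by `‖f‖²`.
  obtain ⟨y, hy1, hy2⟩ := exists_cauchy_solution (s := s) (v := v) hvpos hv.strictMono.injective
    (A := A) (B := B)
    (fun j _ => (Finset.sum_le_sum fun k _ => sqrt_mul_div_add_le hvpos hσ0 hσ j k).trans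
      (sum_pow_dist_le hσ0.le hσ1 j s))
    (fun k _ => abs_prod_div_le hvpos hσ0 hσ1 hσ s k) (fun n => b n)
  set f := polynomialLp Λ lebesgue b with hf
  set g : Lp ℂ 2 lebesgue := ∑ k ∈ s, y k • monomialLp lebesgue (Λ k) with hg
  have hmg : ∀ j ∈ s, inner ℂ (monomialLp lebesgue (Λ j)) g = b j / (v j : ℂ) := by
    intro j hj
    rw [hg, inner_sum, ← hy1 j hj]
    refine Finset.sum_congr rfl fun k _ => ?_
    rw [inner_smul_right, inner_monomialLp_lebesgue (hpos j).le (hpos k).le, mul_one_div, add_comm]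
  have hfg : inner ℂ f g = (E : ℂ) := by
    rw [hf, polynomialLp_eq_sum, sum_inner, hE, Complex.ofReal_sum]
    refine Finset.sum_congr rfl fun j hj => ?_
    rw [inner_smul_left, hmg j hj, ← mul_div_assoc, Complex.conj_mul', Complex.ofReal_div,
      Complex.ofReal_pow]
  have hgg : ‖g‖ ^ 2 ≤ 4 * B ^ 2 * A * E := by
    have : ‖inner ℂ g g‖ ≤ 4 * B ^ 2 * A * E := by
      refine le_of_eq_of_le ?_ hy2
      congr 1
      nth_rw 1 [hg]
      rw [sum_inner]
      refine Finset.sum_congr rfl fun j hj => ?_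
      rw [inner_smul_left, hmg j hj]
    rwa [inner_self_eq_norm_sq_to_K, norm_pow, RCLike.norm_ofReal, abs_norm] at this
  have hEle : E ≤ ‖f‖ * ‖g‖ := by
    have := norm_inner_le_norm (𝕜 := ℂ) f g
    rwa [hfg, Complex.norm_real, Real.norm_of_nonneg hE0] at this
  have hfin : E ≤ 4 * B ^ 2 * A * ‖f‖ ^ 2 := by
    rcases hE0.eq_or_lt with h | h
    · rw [← h]; positivity
    · have h2 : E * E ≤ (4 * B ^ 2 * A * ‖f‖ ^ 2) * E := by
        calc E * E ≤ (‖f‖ * ‖g‖) * (‖f‖ * ‖g‖) := by gcongr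
          _ = ‖f‖ ^ 2 * ‖g‖ ^ 2 := by ring
          _ ≤ ‖f‖ ^ 2 * (4 * B ^ 2 * A * E) := by gcongr
          _ = _ := by ring
      exact le_of_mul_le_mul_right h2 h
  calc _ ≤ K * E := hcomp
    _ ≤ K * (4 * B ^ 2 * A * ‖f‖ ^ 2) := by gcongr
    _ = _ := by ring

theorem exists_riesz_upper {Λ : ℕ → ℝ} (hΛ : IsLacunary Λ) :
    ∃ A : ℝ, 0 < A ∧ ∀ (s : Finset ℕ) (c : ℕ → ℂ),
      ‖∑ n ∈ s, c n • monomialLp lebesgue (Λ n)‖ ^ 2 ≤ A * ∑ n ∈ s, ‖c n‖ ^ 2 / Λ n := by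
  have hpos := hΛ.1
  obtain ⟨σ, hσ0, hσ1, hσ⟩ := exists_decay hΛ
  have hσ' : 0 < 1 - σ := by linarith
  refine ⟨2 / (1 - σ), by positivity, fun s c => ?_⟩
  set g := ∑ n ∈ s, c n • monomialLp lebesgue (Λ n) with hg
  have h1 : ‖inner ℂ g g‖ ≤ ∑ j ∈ s, ∑ k ∈ s, ‖c j‖ * ‖c k‖ / (Λ j + Λ k) := by
    rw [hg, sum_inner]
    refine (norm_sum_le _ _).trans (Finset.sum_le_sum fun j _ => ?_)
    rw [inner_sum]
    refine (norm_sum_le _ _).trans (Finset.sum_le_sum fun k _ => ?_)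
    have hj := hpos j
    have hk := hpos k
    rw [inner_smul_left, inner_smul_right, inner_monomialLp_lebesgue hj.le hk.le, norm_mul,
      norm_mul, RCLike.norm_conj, norm_div, norm_one, Complex.norm_real,
      Real.norm_of_nonneg (by positivity), ← mul_assoc, mul_one_div]
    gcongr <;> linarith
  rw [inner_self_eq_norm_sq_to_K, norm_pow, RCLike.norm_ofReal, abs_norm] at h1
  exact h1.trans (sum_sum_mul_div_add_le hpos fun j _ =>
    (Finset.sum_le_sum fun k _ => sqrt_mul_div_add_le hpos hσ0 hσ j k).trans
      (sum_pow_dist_le hσ0.le hσ1 j s))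

/-- The normalized monomials of a lacunary sequence form a Bessel sequence in `L²(m)`. -/
theorem exists_bessel {Λ : ℕ → ℝ} (hΛ : IsLacunary Λ) :
    ∃ A : ℝ, 0 < A ∧ ∀ (s : Finset ℕ) (f : Lp ℂ 2 lebesgue),
      ∑ n ∈ s, Λ n * ‖inner ℂ (monomialLp lebesgue (Λ n)) f‖ ^ 2 ≤ A * ‖f‖ ^ 2 := by
  have hpos := hΛ.1
  obtain ⟨A, hA, h⟩ := exists_riesz_upper hΛ
  refine ⟨A, hA, fun s f => ?_⟩
  set E := ∑ n ∈ s, Λ n * ‖inner ℂ (monomialLp lebesgue (Λ n)) f‖ ^ 2 with hE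
  have hE0 : 0 ≤ E := Finset.sum_nonneg fun n _ => by have := hpos n; positivity
  -- Dual of the upper Riesz estimate: these coefficients make `⟨g, f⟩ = E` and `‖g‖² ≤ A E`.
  set c : ℕ → ℂ := fun n => (Λ n : ℂ) * inner ℂ (monomialLp lebesgue (Λ n)) f with hc
  set g := ∑ n ∈ s, c n • monomialLp lebesgue (Λ n) with hg
  have hgg : ‖g‖ ^ 2 ≤ A * E := by
    refine (h s c).trans_eq ?_
    congr 1
    refine Finset.sum_congr rfl fun n _ => ?_
    have := hpos n
    rw [hc, norm_mul, Complex.norm_real, Real.norm_of_nonneg this.le]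
    field_simp
  have hgf : inner ℂ g f = (E : ℂ) := by
    rw [hg, sum_inner, hE, Complex.ofReal_sum]
    refine Finset.sum_congr rfl fun n _ => ?_
    rw [inner_smul_left, hc]
    simp only [map_mul, Complex.conj_ofReal]
    rw [mul_assoc, Complex.conj_mul', Complex.ofReal_mul, Complex.ofReal_pow]
  have hEle : E ≤ ‖g‖ * ‖f‖ := by
    have := norm_inner_le_norm (𝕜 := ℂ) g f
    rwa [hgf, Complex.norm_real, Real.norm_of_nonneg hE0] at this
  rcases hE0.eq_or_lt with h | h
  · rw [← h]; positivity
  · have h2 : E * E ≤ (A * ‖f‖ ^ 2) * E := by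
      calc E * E ≤ (‖g‖ * ‖f‖) * (‖g‖ * ‖f‖) := by gcongr
        _ = ‖g‖ ^ 2 * ‖f‖ ^ 2 := by ring
        _ ≤ (A * E) * ‖f‖ ^ 2 := by gcongr
        _ = _ := by ring
    exact le_of_mul_le_mul_right h2 h

/-! ### Domination by a diagonal form in `L²(μ)`. -/

theorem measurable_normalized (a c : ℝ) :
    Measurable fun t : UnitIco => ENNReal.ofReal (c * (t : ℝ) ^ a) :=
  ENNReal.measurable_ofReal.comp ((measurable_subtype_coe.pow_const a).const_mul c)

theorem D_two_sq (Λ : ℕ → ℝ) (μ : Measure UnitIco) (n : ℕ) :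
    D Λ μ 2 n ^ 2 = ∫⁻ t : UnitIco, ENNReal.ofReal (√(Λ n) * (t : ℝ) ^ Λ n) *
      ∑' k : ℕ, ENNReal.ofReal (√(Λ k) * (t : ℝ) ^ Λ k) ∂μ := by
  rw [D, ← ENNReal.rpow_natCast, ← ENNReal.rpow_mul]
  rw [show (1 / (2 : ℝ)) * ((2 : ℕ) : ℝ) = 1 by norm_num, show (2 : ℝ) - 1 = 1 by norm_num]
  simp only [Real.sqrt_eq_rpow, ENNReal.rpow_one]

theorem enorm_sq_eq_lintegral {μ : Measure UnitIco} (f : Lp ℂ 2 μ) :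
    ‖f‖ₑ ^ 2 = ∫⁻ t, ‖f t‖ₑ ^ 2 ∂μ := by
  rw [Lp.enorm_def, eLpNorm_eq_lintegral_rpow_enorm_toReal two_ne_zero ENNReal.ofNat_ne_top,
    ← ENNReal.rpow_natCast, ← ENNReal.rpow_mul]
  norm_num

/-- The form comparison: in terms of the weighted coefficients, the `L²(μ)` norm is dominated by
the diagonal operator with entries `Dₙ(2)`. -/
theorem enorm_sum_monomialLp_sq_le {Λ : ℕ → ℝ} (hpos : ∀ n, 0 < Λ n) (μ : Measure UnitIco)
    [IsFiniteMeasure μ] (s : Finset ℕ) (b : ℕ → ℂ) :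
    ‖∑ n ∈ s, b n • monomialLp μ (Λ n)‖ₑ ^ 2 ≤
      ∑ n ∈ s, ENNReal.ofReal (‖b n‖ ^ 2 / Λ n) * D Λ μ 2 n ^ 2 := by
  set g : ℕ → UnitIco → ℝ := fun n t => √(Λ n) * (t : ℝ) ^ Λ n with hg
  have hg0 : ∀ n t, 0 ≤ g n t := fun n t =>
    mul_nonneg (Real.sqrt_nonneg _) (Real.rpow_nonneg t.2.1 _)
  have hae : ∀ᵐ t ∂μ, (∑ n ∈ s, b n • monomialLp μ (Λ n) : Lp ℂ 2 μ) t =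
      ∑ n ∈ s, b n * monomial (Λ n) t := by
    have h1 : ∀ n, ∀ᵐ t ∂μ, (b n • monomialLp μ (Λ n) : Lp ℂ 2 μ) t = b n * monomial (Λ n) t := by
      intro n
      filter_upwards [Lp.coeFn_smul (b n) (monomialLp μ (Λ n)), coeFn_monomialLp μ (hpos n).le]
        with t h1 h2
      rw [h1, Pi.smul_apply, h2, smul_eq_mul]
    filter_upwards [Lp.coeFn_finsetSum s (fun n => b n • monomialLp μ (Λ n)),
      ae_all_iff.2 h1] with t h2 h3
    rw [h2, Finset.sum_apply]
    exact Finset.sum_congr rfl fun n _ => h3 n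
  have hpt : ∀ t : UnitIco, ‖∑ n ∈ s, b n * monomial (Λ n) t‖ₑ ^ 2 ≤
      ∑ n ∈ s, ENNReal.ofReal (‖b n‖ ^ 2 / Λ n) *
        (ENNReal.ofReal (g n t) * ∑' k, ENNReal.ofReal (g k t)) := by
    intro t
    have hreal : ‖∑ n ∈ s, b n * monomial (Λ n) t‖ ^ 2 ≤
        (∑ n ∈ s, ‖b n‖ ^ 2 / Λ n * g n t) * ∑ n ∈ s, g n t := by
      calc _ ≤ (∑ n ∈ s, ‖b n‖ * (t : ℝ) ^ Λ n) ^ 2 := by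
            gcongr
            refine (norm_sum_le _ _).trans_eq (Finset.sum_congr rfl fun n _ => ?_)
            rw [norm_mul, monomial, Complex.norm_real,
              Real.norm_of_nonneg (Real.rpow_nonneg t.2.1 _)]
        _ ≤ _ := by
            -- Cauchy–Schwarz with `(|bₙ| t^λₙ)² = (|bₙ|²/λₙ · gₙ) · gₙ`; the second sum is later
            -- enlarged to the full series in `Dₙ(2)`.
            refine Finset.sum_sq_le_sum_mul_sum_of_sq_le_mul s (fun n _ => ?_) (fun n _ => hg0 n t)
              fun n _ => ?_
            · have := hpos n
              exact mul_nonneg (by positivity) (hg0 n t)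
            · have := hpos n
              simp only [hg]
              rw [div_mul_eq_mul_div, div_mul_eq_mul_div, le_div_iff₀ this]
              have := Real.sq_sqrt this.le
              apply le_of_eq
              linear_combination (-1) * ‖b n‖ ^ 2 * ((t : ℝ) ^ Λ n) ^ 2 * this
    rw [← ofReal_norm, ← ENNReal.ofReal_pow (norm_nonneg _)]
    refine (ENNReal.ofReal_le_ofReal hreal).trans ?_
    rw [ENNReal.ofReal_mul (Finset.sum_nonneg fun n _ => by
        have := hpos n
        exact mul_nonneg (by positivity) (hg0 n t)),
      ENNReal.ofReal_sum_of_nonneg (fun n _ => by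
        have := hpos n
        exact mul_nonneg (by positivity) (hg0 n t)),
      ENNReal.ofReal_sum_of_nonneg (fun n _ => hg0 n t), Finset.sum_mul]
    refine Finset.sum_le_sum fun n _ => ?_
    have := hpos n
    rw [ENNReal.ofReal_mul (by positivity), mul_assoc]
    gcongr
    exact ENNReal.sum_le_tsum s
  rw [enorm_sq_eq_lintegral]
  calc _ ≤ ∫⁻ t, ∑ n ∈ s, ENNReal.ofReal (‖b n‖ ^ 2 / Λ n) *
        (ENNReal.ofReal (g n t) * ∑' k, ENNReal.ofReal (g k t)) ∂μ := by
        refine lintegral_mono_ae ?_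
        filter_upwards [hae] with t ht
        rw [ht]
        exact hpt t
    _ = _ := by
        have hm : ∀ n, Measurable fun t => ENNReal.ofReal (g n t) *
            ∑' k, ENNReal.ofReal (g k t) := fun n =>
          (measurable_normalized _ _).mul (Measurable.tsum fun k => measurable_normalized _ _)
        rw [lintegral_finsetSum _ fun n _ => (hm n).const_mul _]
        refine Finset.sum_congr rfl fun n _ => ?_
        rw [lintegral_const_mul _ (hm n), D_two_sq]

/-! ### Approximation numbers and greedy rearrangement. -/

section Approximation

variable {X Y : Type*} [NormedAddCommGroup X] [NormedSpace ℂ X]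
  [NormedAddCommGroup Y] [NormedSpace ℂ Y]

theorem isCompactOperator_of_rank_lt {R : X →L[ℂ] Y} {n : ℕ}
    (h : (R : X →ₗ[ℂ] Y).rank < (n : Cardinal)) : IsCompactOperator R := by
  have hfin : FiniteDimensional ℂ (LinearMap.range (R : X →ₗ[ℂ] Y)) :=
    Module.rank_lt_aleph0_iff.1 (h.trans Cardinal.natCast_lt_aleph0)
  have : ProperSpace (LinearMap.range (R : X →ₗ[ℂ] Y)) := FiniteDimensional.proper ℂ _
  have h1 : IsCompactOperator (R.codRestrict (LinearMap.range (R : X →ₗ[ℂ] Y)) fun x =>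
      LinearMap.mem_range_self (R : X →ₗ[ℂ] Y) x) :=
    isCompactOperator_of_locallyCompactSpace_dom _
  exact h1.clm_comp (LinearMap.range (R : X →ₗ[ℂ] Y)).subtypeL

/-- An operator whose approximation numbers are `q`-summable is compact. -/
theorem isCompactOperator_of_tsum_lt_top [CompleteSpace Y] {S : X →L[ℂ] Y} {q : ℝ} (hq : 0 < q)
    (h : ∑' n : ℕ, approxNumber S (n + 1) ^ q < ∞) : IsCompactOperator S := by
  have hcl := isClosed_setOfPred_isCompactOperator (σ₁₂ := RingHom.id ℂ) (M₁ := X) (M₂ := Y)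
  refine hcl.closure_subset (EMetric.mem_closure_iff.2 fun ε hε => ?_)
  have hlim := ENNReal.tendsto_atTop_zero_of_tsum_ne_top h.ne
  obtain ⟨n, hn⟩ := (hlim.eventually_lt_const (ENNReal.rpow_pos_of_nonneg (p := q) hε hq.le)).exists
  rw [ENNReal.rpow_lt_rpow_iff hq] at hn
  simp only [approxNumber, iInf_lt_iff] at hn
  obtain ⟨R, hR, hlt⟩ := hn
  exact ⟨R, isCompactOperator_of_rank_lt hR, by rwa [edist_eq_enorm_sub]⟩

end Approximation

/-- Summability makes superlevel sets at positive levels finite, so the supremum off `F` is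
attained. This allows the largest terms to be picked one at a time. -/
theorem exists_forall_notMem_le {u : ℕ → ℝ≥0∞} {q : ℝ} (hq : 0 < q) (hu : ∑' n, u n ^ q < ∞)
    (F : Finset ℕ) : ∃ k ∉ F, ∀ j ∉ F, u j ≤ u k := by
  by_cases h : ∀ j ∉ F, u j = 0
  · obtain ⟨k, hk⟩ := Infinite.exists_notMem_finset F
    exact ⟨k, hk, fun j hj => by simp [h j hj]⟩
  · push Not at h
    obtain ⟨j₀, hj₀, hne⟩ := h
    have hfin : {j | u j₀ ^ q ≤ u j ^ q}.Finite :=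
      ENNReal.finite_const_le_of_tsum_ne_top hu.ne
        (by simpa [ENNReal.rpow_eq_zero_iff, hq, hq.not_gt] using hne)
    obtain ⟨k, hk, hmax⟩ := Set.exists_max_image ({j | u j₀ ^ q ≤ u j ^ q} \ F) u
      (hfin.subset Set.sdiff_subset) ⟨j₀, le_refl (u j₀ ^ q), by simpa using hj₀⟩
    refine ⟨k, by simpa using hk.2, fun j hj => ?_⟩
    by_cases hjj : u j₀ ≤ u j
    · exact hmax j ⟨ENNReal.rpow_le_rpow hjj hq.le, by simpa using hj⟩
    · have := hmax j₀ ⟨le_refl (u j₀ ^ q), by simpa using hj₀⟩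
      exact (le_of_not_ge hjj).trans this

/-- A sequence dominated by the tails of `u` is dominated in `ℓ^q` by `u`. -/
theorem tsum_rpow_le_of_forall_card {u a : ℕ → ℝ≥0∞} {q : ℝ} (hq : 0 < q)
    (hu : ∑' n, u n ^ q < ∞) {C : ℝ≥0∞}
    (h : ∀ (F : Finset ℕ) (k : ℕ), (∀ j ∉ F, u j ≤ u k) → a F.card ≤ C * u k) :
    ∑' n, a n ^ q ≤ C ^ q * ∑' n, u n ^ q := by
  -- Greedy choice: `F` gains the index of the largest remaining `u k`, which dominates `a N` since
  -- `F` has `N` elements.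
  have key : ∀ N : ℕ, ∃ F : Finset ℕ, F.card = N ∧
      ∑ n ∈ Finset.range N, a n ^ q ≤ C ^ q * ∑ k ∈ F, u k ^ q := by
    intro N
    induction N with
    | zero => exact ⟨∅, rfl, by simp⟩
    | succ N ih =>
      obtain ⟨F, hF, hle⟩ := ih
      obtain ⟨k, hk, hmax⟩ := exists_forall_notMem_le hq hu F
      refine ⟨insert k F, by rw [Finset.card_insert_of_notMem hk, hF], ?_⟩
      rw [Finset.sum_range_succ, Finset.sum_insert hk, mul_add, add_comm]
      refine add_le_add ?_ hle
      rw [← ENNReal.mul_rpow_of_nonneg _ _ hq.le, ← hF]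
      exact ENNReal.rpow_le_rpow (h F k hmax) hq.le
  refine ENNReal.tsum_le_of_sum_range_le fun N => ?_
  obtain ⟨F, -, hle⟩ := key N
  exact hle.trans (mul_le_mul_right (ENNReal.sum_le_tsum F) _)

/-! ### Truncation of coefficients and the upper Schatten bound. -/

/-- The coefficient functional of `t ^ λₙ` on the Müntz space. -/
def coeffFunctional (Λ : ℕ → ℝ) (n : ℕ) : muntzSpace Λ →L[ℂ] ℂ :=
  (Finsupp.lapply n : (ℕ →₀ ℂ) →ₗ[ℂ] ℂ).extendOfNorm (polynomialMuntz Λ)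

/-- The lower Riesz estimate makes each coefficient continuous in the `L²(m)` norm, which
legitimises the extension. -/
theorem coeffFunctional_polynomial {Λ : ℕ → ℝ} (hΛ : IsLacunary Λ) (n : ℕ) (b : ℕ →₀ ℂ) :
    coeffFunctional Λ n (polynomialMuntz Λ b) = b n := by
  obtain ⟨C, hC, h⟩ := exists_riesz_lower hΛ
  refine LinearMap.extendOfNorm_eq (denseRange_polynomialMuntz Λ) ⟨√(Λ n) * C, fun b => ?_⟩ b
  have hn := hΛ.1 n
  change ‖b n‖ ≤ √(Λ n) * C * ‖polynomialLp Λ lebesgue b‖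
  by_cases hb : b n = 0
  · rw [hb, norm_zero]; positivity
  · have h1 : ‖b n‖ ^ 2 / Λ n ≤ C ^ 2 * ‖polynomialLp Λ lebesgue b‖ ^ 2 :=
      (Finset.single_le_sum (f := fun n => ‖b n‖ ^ 2 / Λ n)
        (fun i _ => by have := hΛ.1 i; positivity) (Finsupp.mem_support_iff.2 hb)).trans (h b)
    rw [div_le_iff₀ hn] at h1
    refine abs_le_of_sq_le_sq' ?_ (by positivity) |>.2
    rw [mul_pow, mul_pow, Real.sq_sqrt hn.le]
    linarith

/-- Diagonal domination followed by the lower Riesz estimate for the whole polynomial. Empty `F`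
yields the Carleson property, general `F` the approximation numbers. -/
theorem norm_sum_sdiff_le {Λ : ℕ → ℝ} (hpos : ∀ n, 0 < Λ n) {C : ℝ} (hC : 0 < C)
    (h : ∀ b : ℕ →₀ ℂ,
      ∑ n ∈ b.support, ‖b n‖ ^ 2 / Λ n ≤ C ^ 2 * ‖polynomialLp Λ lebesgue b‖ ^ 2)
    (μ : Measure UnitIco) [IsFiniteMeasure μ] (F : Finset ℕ) (M : ℝ≥0)
    (hM : ∀ n ∉ F, D Λ μ 2 n ≤ M) (b : ℕ →₀ ℂ) :
    ‖∑ n ∈ b.support \ F, b n • monomialLp μ (Λ n)‖ ≤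
      C * M * ‖polynomialLp Λ lebesgue b‖ := by
  have hterm : ∀ n, 0 ≤ ‖b n‖ ^ 2 / Λ n := fun n => by have := hpos n; positivity
  have h1 : ‖∑ n ∈ b.support \ F, b n • monomialLp μ (Λ n)‖ₑ ^ 2 ≤
      ENNReal.ofReal ((C * M * ‖polynomialLp Λ lebesgue b‖) ^ 2) := by
    refine (enorm_sum_monomialLp_sq_le hpos μ _ b).trans ?_
    calc _ ≤ ∑ n ∈ b.support \ F, ENNReal.ofReal (‖b n‖ ^ 2 / Λ n) * (M : ℝ≥0∞) ^ 2 := by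
          refine Finset.sum_le_sum fun n hn => ?_
          gcongr
          exact hM n (Finset.mem_sdiff.1 hn).2
      _ = ENNReal.ofReal ((∑ n ∈ b.support \ F, ‖b n‖ ^ 2 / Λ n) * (M : ℝ) ^ 2) := by
          rw [← Finset.sum_mul, ← ENNReal.ofReal_sum_of_nonneg fun n _ => hterm n,
            ENNReal.ofReal_mul (Finset.sum_nonneg fun n _ => hterm n),
            ENNReal.ofReal_pow M.coe_nonneg, ENNReal.ofReal_coe_nnreal]
      _ ≤ _ := by
          refine ENNReal.ofReal_le_ofReal ?_
          calc _ ≤ (C ^ 2 * ‖polynomialLp Λ lebesgue b‖ ^ 2) * (M : ℝ) ^ 2 := by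
                gcongr
                exact (Finset.sum_le_sum_of_subset_of_nonneg Finset.sdiff_subset
                  fun n _ _ => hterm n).trans (h b)
            _ = _ := by ring
  rw [← ofReal_norm, ← ENNReal.ofReal_pow (norm_nonneg _),
    ENNReal.ofReal_le_ofReal_iff (by positivity)] at h1
  exact (abs_le_of_sq_le_sq' h1 (by positivity)).2

theorem isCarleson_of_D_le {Λ : ℕ → ℝ} (hΛ : IsLacunary Λ) (μ : Measure UnitIco)
    [IsFiniteMeasure μ] (M : ℝ≥0) (hM : ∀ n, D Λ μ 2 n ≤ M) : IsCarleson Λ μ := by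
  obtain ⟨C, hC, h⟩ := exists_riesz_lower hΛ
  refine ⟨C * M, fun b => ?_⟩
  have := norm_sum_sdiff_le hΛ.1 hC h μ ∅ M (fun n _ => hM n) b
  rwa [Finset.sdiff_empty, ← polynomialLp_eq_sum] at this

/-- The approximation numbers of the embedding are dominated by the tails of `Dₙ(2)`. -/
theorem approxNumber_carlesonEmbedding_le {Λ : ℕ → ℝ} (hΛ : IsLacunary Λ) {C : ℝ} (hC : 0 < C)
    (h : ∀ b : ℕ →₀ ℂ,
      ∑ n ∈ b.support, ‖b n‖ ^ 2 / Λ n ≤ C ^ 2 * ‖polynomialLp Λ lebesgue b‖ ^ 2)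
    {μ : Measure UnitIco} [IsFiniteMeasure μ] (hμ : IsCarleson Λ μ) (F : Finset ℕ) (M : ℝ≥0)
    (hM : ∀ n ∉ F, D Λ μ 2 n ≤ M) :
    approxNumber (carlesonEmbedding Λ μ) (F.card + 1) ≤ ENNReal.ofReal C * M := by
  -- `R` keeps only the coefficients in `F`. Its rank is at most `F.card`, and the strict rank
  -- condition accounts for the index `F.card + 1`.
  set R : muntzSpace Λ →L[ℂ] Lp ℂ 2 μ :=
    ∑ k ∈ F, (coeffFunctional Λ k).smulRight (monomialLp μ (Λ k)) with hR
  have hRapp : ∀ x, R x = ∑ k ∈ F, coeffFunctional Λ k x • monomialLp μ (Λ k) := fun x => by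
    simp [hR]
  have hrank : (R : muntzSpace Λ →ₗ[ℂ] Lp ℂ 2 μ).rank < ((F.card + 1 : ℕ) : Cardinal) := by
    classical
    have hle : LinearMap.range (R : muntzSpace Λ →ₗ[ℂ] Lp ℂ 2 μ) ≤
        Submodule.span ℂ (F.image fun k => monomialLp μ (Λ k) : Finset (Lp ℂ 2 μ)) := by
      rintro _ ⟨x, rfl⟩
      rw [ContinuousLinearMap.coe_coe, hRapp]
      refine Submodule.sum_mem _ fun k hk => Submodule.smul_mem _ _ (Submodule.subset_span ?_)
      exact_mod_cast Finset.mem_image_of_mem _ hk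
    have h1 := (Submodule.rank_mono hle).trans (rank_span_finset_le _)
    refine lt_of_le_of_lt h1 ?_
    exact_mod_cast Nat.lt_succ_of_le Finset.card_image_le
  have hbound : ∀ x, ‖(carlesonEmbedding Λ μ - R) x‖ ≤ C * M * ‖x‖ := by
    intro x
    refine (denseRange_polynomialMuntz Λ).induction_on
      (p := fun x => ‖(carlesonEmbedding Λ μ - R) x‖ ≤ C * M * ‖x‖) x
      (isClosed_le (by fun_prop) (by fun_prop)) fun b => ?_
    have : (carlesonEmbedding Λ μ - R) (polynomialMuntz Λ b) =
        ∑ n ∈ b.support \ F, b n • monomialLp μ (Λ n) := by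
      rw [sub_apply, carlesonEmbedding_polynomial hμ, hRapp,
        polynomialLp_eq_sum, sub_eq_iff_eq_add, add_comm,
        ← Finset.sum_inter_add_sum_sdiff _ F]
      simp only [coeffFunctional_polynomial hΛ]
      congr 1
      refine Finset.sum_subset Finset.inter_subset_right fun k hk hk' => ?_
      have : b k = 0 := by
        by_contra hb
        exact hk' (Finset.mem_inter.2 ⟨Finsupp.mem_support_iff.2 hb, hk⟩)
      rw [this, zero_smul]
    rw [this]
    exact norm_sum_sdiff_le hΛ.1 hC h μ F M hM b
  refine (iInf₂_le R hrank).trans ?_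
  have := ContinuousLinearMap.opNorm_le_bound _ (by positivity) hbound
  rw [← ofReal_norm]
  refine (ENNReal.ofReal_le_ofReal this).trans_eq ?_
  rw [ENNReal.ofReal_mul hC.le, ENNReal.ofReal_coe_nnreal]

/-- The constant is the lower Riesz constant, so it does not even depend on `q`. The Carleson
property follows first, from `sup Dₙ ≤ ‖D‖_{ℓ^q}`. -/
theorem memSchatten_and_schattenNorm_le {Λ : ℕ → ℝ} (hΛ : IsLacunary Λ) {q : ℝ} (hq : 0 < q) :
    ∃ C : ℝ≥0, 0 < C ∧ ∀ (μ : Measure UnitIco) [IsFiniteMeasure μ],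
      ellNorm q (D Λ μ 2) < ∞ →
        IsCarleson Λ μ ∧ MemSchatten q (carlesonEmbedding Λ μ) ∧
          schattenNorm q (carlesonEmbedding Λ μ) ≤ C * ellNorm q (D Λ μ 2) := by
  obtain ⟨C, hC, h⟩ := exists_riesz_lower hΛ
  refine ⟨C.toNNReal, Real.toNNReal_pos.2 hC, fun μ _ hfin => ?_⟩
  have hq' : 0 < 1 / q := by positivity
  have hsum : ∑' n, D Λ μ 2 n ^ q < ∞ := by
    rwa [ellNorm, ENNReal.rpow_lt_top_iff_of_pos hq'] at hfin
  have hle : ∀ n, D Λ μ 2 n ≤ ellNorm q (D Λ μ 2) := fun n => by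
    rw [ellNorm, one_div, ENNReal.le_rpow_inv_iff hq]
    exact ENNReal.le_tsum n
  have hCar : IsCarleson Λ μ := isCarleson_of_D_le hΛ μ (ellNorm q (D Λ μ 2)).toNNReal fun n => by
    rw [ENNReal.coe_toNNReal hfin.ne]
    exact hle n
  have hmain : ∑' n : ℕ, approxNumber (carlesonEmbedding Λ μ) (n + 1) ^ q ≤
      ENNReal.ofReal C ^ q * ∑' n, D Λ μ 2 n ^ q := by
    refine tsum_rpow_le_of_forall_card hq hsum fun F k hk => ?_
    have hk' : D Λ μ 2 k ≠ ∞ := ((hle k).trans_lt hfin).ne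
    have := approxNumber_carlesonEmbedding_le hΛ hC h hCar F (D Λ μ 2 k).toNNReal fun n hn => by
      rw [ENNReal.coe_toNNReal hk']
      exact hk n hn
    rwa [ENNReal.coe_toNNReal hk'] at this
  have hlt : ∑' n : ℕ, approxNumber (carlesonEmbedding Λ μ) (n + 1) ^ q < ∞ :=
    hmain.trans_lt (ENNReal.mul_lt_top
      (ENNReal.rpow_lt_top_of_nonneg hq.le ENNReal.ofReal_ne_top) hsum)
  refine ⟨hCar, ⟨isCompactOperator_of_tsum_lt_top hq hlt, hlt⟩, ?_⟩
  refine (ENNReal.rpow_le_rpow hmain hq'.le).trans_eq ?_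
  rw [ENNReal.mul_rpow_of_nonneg _ _ hq'.le, ← ENNReal.rpow_mul, mul_one_div_cancel hq.ne',
    ENNReal.rpow_one]
  rfl

/-! ### Singular values in finite dimension. -/

section SingularValues

open Module

variable {V W : Type*} [NormedAddCommGroup V] [InnerProductSpace ℂ V] [FiniteDimensional ℂ V]
  [NormedAddCommGroup W] [InnerProductSpace ℂ W] [FiniteDimensional ℂ W]

/-- An orthonormal basis of right singular vectors. -/
def singularBasis (L : V →ₗ[ℂ] W) : OrthonormalBasis (Fin (finrank ℂ V)) ℂ V :=
  L.isSymmetric_adjoint_comp_self.eigenvectorBasis rfl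

theorem norm_sq_eq_sum_singularValues (L : V →ₗ[ℂ] W) (x : V) :
    ‖L x‖ ^ 2 = ∑ i, ‖inner ℂ (singularBasis L i) x‖ ^ 2 * L.singularValues i ^ 2 := by
  have h1 : inner ℂ (L x) (L x) = inner ℂ x ((LinearMap.adjoint L ∘ₗ L) x) := by
    rw [LinearMap.comp_apply, LinearMap.adjoint_inner_right]
  rw [← (singularBasis L).sum_inner_mul_inner, inner_self_eq_norm_sq_to_K] at h1
  have h2 : ∀ i, inner ℂ x (singularBasis L i) *
      inner ℂ (singularBasis L i) ((LinearMap.adjoint L ∘ₗ L) x) =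
      ((‖inner ℂ (singularBasis L i) x‖ ^ 2 * L.singularValues i ^ 2 : ℝ) : ℂ) := by
    intro i
    rw [← OrthonormalBasis.repr_apply_apply, singularBasis,
      LinearMap.IsSymmetric.eigenvectorBasis_apply_self_apply, OrthonormalBasis.repr_apply_apply,
      ← L.sq_singularValues_fin rfl, ← inner_conj_symm, Complex.ofReal_mul, Complex.ofReal_pow,
      ← Complex.conj_mul']
    change _ * (((L.singularValues i ^ 2 : ℝ) : ℂ) * _) = _
    ring
  simp only [h2] at h1
  rw [← Complex.ofReal_sum] at h1
  refine Complex.ofReal_injective ?_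
  rw [← h1, Complex.ofReal_pow]
  rfl

/-- Min-max by dimension count: the span of the first `i + 1` singular vectors meets the kernel of
`R`, and there `L` expands norms by at least the `i`-th singular value (counted from zero). -/
theorem exists_norm_le_of_finrank_range_le (L : V →ₗ[ℂ] W) {Z : Type*} [AddCommGroup Z]
    [Module ℂ Z] (R : V →ₗ[ℂ] Z) (i : Fin (finrank ℂ V))
    (hR : finrank ℂ (LinearMap.range R) ≤ i) :
    ∃ x : V, x ≠ 0 ∧ R x = 0 ∧ L.singularValues i * ‖x‖ ≤ ‖L x‖ := by
  set v : Fin (i + 1) → V := fun j => singularBasis L (j.castLE i.2) with hv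
  set Φ : (Fin (i + 1) → ℂ) →ₗ[ℂ] V := Fintype.linearCombination ℂ v with hΦ
  have hvo : Orthonormal ℂ v := (singularBasis L).orthonormal.comp _ (Fin.castLE_injective _)
  have hΦinj : Function.Injective Φ := hvo.linearIndependent.fintypeLinearCombination_injective
  have hnot : ¬ Function.Injective (R ∘ₗ Φ) := by
    intro hinj
    have h1 := LinearMap.finrank_range_of_inj hinj
    have h2 : finrank ℂ (LinearMap.range (R ∘ₗ Φ)) ≤ finrank ℂ (LinearMap.range R) :=
      Submodule.finrank_mono (LinearMap.range_comp_le_range Φ R)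
    rw [h1, finrank_fin_fun] at h2
    omega
  rw [← LinearMap.ker_eq_bot, Submodule.eq_bot_iff] at hnot
  push Not at hnot
  obtain ⟨c, hc, hc0⟩ := hnot
  refine ⟨Φ c, fun h => hc0 (hΦinj (h.trans (map_zero Φ).symm)), hc, ?_⟩
  have hcoord : ∀ k : Fin (finrank ℂ V), i < k → inner ℂ (singularBasis L k) (Φ c) = 0 := by
    intro k hk
    rw [hΦ, Fintype.linearCombination_apply, inner_sum]
    refine Finset.sum_eq_zero fun j _ => ?_
    rw [inner_smul_right, hv, (singularBasis L).inner_eq_zero, mul_zero]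
    intro h
    have := j.2
    rw [h] at hk
    have hk' : (i : ℕ) < j := hk
    omega
  refine abs_le_of_sq_le_sq' ?_ (norm_nonneg _) |>.2
  rw [norm_sq_eq_sum_singularValues, mul_pow, ← (singularBasis L).sum_sq_norm_inner_right,
    Finset.mul_sum]
  refine Finset.sum_le_sum fun k _ => ?_
  rcases lt_or_ge i k with hk | hk
  · rw [hcoord k hk]; simp
  · rw [mul_comm]
    gcongr
    · exact L.singularValues_nonneg i
    · exact L.singularValues_antitone hk

end SingularValues

/-! ### Bessel sequences and approximation numbers. -/

section Hilbert

open Module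

variable {H Y : Type*} [NormedAddCommGroup H] [InnerProductSpace ℂ H]
  [NormedAddCommGroup Y] [InnerProductSpace ℂ Y]

/-- For `q ≥ 2`, the values of an operator on a Bessel sequence are controlled in `ℓ^q` by its
approximation numbers. -/
theorem sum_enorm_rpow_le_tsum_approxNumber (S : H →L[ℂ] Y) {q : ℝ} (hq : 2 ≤ q) (g : ℕ → H)
    (hg : ∀ n, ‖g n‖ ≤ 1) {B : ℝ} (T : Finset ℕ)
    (hB : ∀ f : H, ∑ n ∈ T, ‖inner ℂ (g n) f‖ ^ 2 ≤ B * ‖f‖ ^ 2) :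
    ∑ n ∈ T, ‖S (g n)‖ₑ ^ q ≤ ENNReal.ofReal B * ∑' i : ℕ, approxNumber S (i + 1) ^ q := by
  have hq0 : 0 < q := by linarith
  -- Restricting to the finite-dimensional span of the vectors involved gives access to a singular
  -- basis without compactness of `S`.
  set V : Submodule ℂ H := Submodule.span ℂ (g '' T) with hV
  have hVfin : FiniteDimensional ℂ V :=
    FiniteDimensional.span_of_finite ℂ (T.finite_toSet.image g)
  set L₀ : V →ₗ[ℂ] Y := (S : H →ₗ[ℂ] Y) ∘ₗ V.subtype with hL₀
  set L : V →ₗ[ℂ] LinearMap.range L₀ := L₀.rangeRestrict with hL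
  have hLnorm : ∀ x : V, ‖L x‖ = ‖S x‖ := fun x => rfl
  set e := singularBasis L with he
  set σ : ℕ → ℝ := fun i => L.singularValues i with hσ
  have hσ0 : ∀ i, 0 ≤ σ i := fun i => L.singularValues_nonneg i
  have hσa : ∀ i : Fin (finrank ℂ V), ENNReal.ofReal (σ i) ≤ approxNumber S (i + 1) := by
    intro i
    refine le_iInf₂ fun R hR => ?_
    have hfin : FiniteDimensional ℂ (LinearMap.range (R : H →ₗ[ℂ] Y)) :=
      Module.rank_lt_aleph0_iff.1 (lt_trans hR Cardinal.natCast_lt_aleph0)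
    have hR' : finrank ℂ (LinearMap.range (R : H →ₗ[ℂ] Y)) < i + 1 :=
      Module.finrank_lt_of_rank_lt hR
    have hle : finrank ℂ (LinearMap.range ((R : H →ₗ[ℂ] Y) ∘ₗ V.subtype)) ≤ i :=
      (Submodule.finrank_mono (LinearMap.range_comp_le_range _ _)).trans (Nat.le_of_lt_succ hR')
    obtain ⟨x, hx0, hRx, hx⟩ := exists_norm_le_of_finrank_range_le L _ i hle
    rw [← ofReal_norm]
    refine ENNReal.ofReal_le_ofReal ?_
    have hxpos : 0 < ‖x‖ := norm_pos_iff.2 hx0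
    have h1 : ‖S x‖ ≤ ‖S - R‖ * ‖x‖ := by
      have h2 := (S - R).le_opNorm (x : H)
      have h3 : R (x : H) = 0 := hRx
      rwa [sub_apply, h3, sub_zero] at h2
    exact le_of_mul_le_mul_right (hx.trans ((hLnorm x).le.trans h1)) hxpos
  set w : ℕ → Fin (finrank ℂ V) → ℝ := fun n i => ‖inner ℂ (g n) (e i : H)‖ ^ 2 with hw
  -- Jensen's inequality with exponent `q/2 ≥ 1`, where `q ≥ 2` enters; the weights have total mass
  -- at most `1` because `‖g n‖ ≤ 1`.
  have hterm : ∀ n ∈ T, ‖S (g n)‖ ^ q ≤ ∑ i, w n i * σ i ^ q := by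
    intro n hn
    set x : V := ⟨g n, Submodule.subset_span ⟨n, hn, rfl⟩⟩ with hx
    have hwx : ∀ i, ‖inner ℂ (e i) x‖ ^ 2 = w n i := fun i => by
      rw [hw, norm_inner_symm]; rfl
    have h1 : ‖S (g n)‖ ^ 2 = ∑ i, w n i * σ i ^ 2 := by
      rw [show ‖S (g n)‖ = ‖L x‖ from rfl, norm_sq_eq_sum_singularValues]
      exact Finset.sum_congr rfl fun i _ => by rw [← hwx]
    have h2 : ∑ i, w n i ≤ 1 := by
      simp only [← hwx]
      rw [e.sum_sq_norm_inner_right]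
      exact pow_le_one₀ (norm_nonneg _) (hg n)
    have hw0 : ∀ i, 0 ≤ w n i := fun i => by positivity
    set p := q / 2 with hp
    have hp1 : 1 ≤ p := by rw [hp]; linarith
    have hp0 : 0 < p := by linarith
    have hσp : ∀ i, (σ i ^ 2) ^ p = σ i ^ q := fun i => by
      rw [← Real.rpow_natCast, ← Real.rpow_mul (hσ0 i), hp]
      congr 1
      push_cast
      ring
    have h3 := Real.inner_le_weight_mul_Lp_of_nonneg Finset.univ hp1 (w n)
      (fun i => σ i ^ 2) hw0 fun i => sq_nonneg _
    rw [← h1] at h3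
    simp only [hσp] at h3
    have hs0 : 0 ≤ ∑ i, w n i * σ i ^ q := Finset.sum_nonneg fun i _ =>
      mul_nonneg (hw0 i) (Real.rpow_nonneg (hσ0 i) q)
    have h4 : ‖S (g n)‖ ^ 2 ≤ (∑ i, w n i * σ i ^ q) ^ p⁻¹ := by
      refine h3.trans (mul_le_of_le_one_left (by positivity) ?_)
      exact Real.rpow_le_one (Finset.sum_nonneg fun i _ => hw0 i) h2
        (sub_nonneg.2 (inv_le_one_of_one_le₀ hp1))
    calc ‖S (g n)‖ ^ q = (‖S (g n)‖ ^ 2) ^ p := by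
          rw [← Real.rpow_natCast, ← Real.rpow_mul (norm_nonneg _), hp]
          congr 1
          push_cast
          ring
      _ ≤ ((∑ i, w n i * σ i ^ q) ^ p⁻¹) ^ p := by gcongr
      _ = _ := by rw [← Real.rpow_mul hs0, inv_mul_cancel₀ hp0.ne', Real.rpow_one]
  have hsum : ∑ n ∈ T, ‖S (g n)‖ ^ q ≤ ∑ i : Fin (finrank ℂ V), B * σ i ^ q := by
    refine (Finset.sum_le_sum hterm).trans ?_
    rw [Finset.sum_comm]
    refine Finset.sum_le_sum fun i _ => ?_
    rw [← Finset.sum_mul]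
    refine mul_le_mul_of_nonneg_right ?_ (Real.rpow_nonneg (hσ0 i) q)
    -- After exchanging the sums, the Bessel bound is applied to each unit singular vector.
    refine (hB (e i)).trans_eq ?_
    have : ‖(e i : H)‖ = 1 := e.orthonormal.1 i
    rw [this, one_pow, mul_one]
  calc ∑ n ∈ T, ‖S (g n)‖ₑ ^ q = ENNReal.ofReal (∑ n ∈ T, ‖S (g n)‖ ^ q) := by
        rw [ENNReal.ofReal_sum_of_nonneg fun n _ => by positivity]
        refine Finset.sum_congr rfl fun n _ => ?_
        rw [← ofReal_norm, ENNReal.ofReal_rpow_of_nonneg (norm_nonneg _) hq0.le]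
    _ ≤ ENNReal.ofReal (∑ i : Fin (finrank ℂ V), B * σ i ^ q) := ENNReal.ofReal_le_ofReal hsum
    _ = ENNReal.ofReal B * ∑ i : Fin (finrank ℂ V), ENNReal.ofReal (σ i) ^ q := by
        have h0 : ∀ i : Fin (finrank ℂ V), 0 ≤ σ i ^ q := fun i => Real.rpow_nonneg (hσ0 i) q
        have hs0 : 0 ≤ ∑ i : Fin (finrank ℂ V), σ i ^ q := Finset.sum_nonneg fun i _ => h0 i
        rw [← Finset.mul_sum, ENNReal.ofReal_mul' hs0,
          ENNReal.ofReal_sum_of_nonneg fun i _ => h0 i]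
        congr 1
        refine Finset.sum_congr rfl fun i _ => ?_
        rw [ENNReal.ofReal_rpow_of_nonneg (hσ0 i) hq0.le]
    _ ≤ ENNReal.ofReal B * ∑ i : Fin (finrank ℂ V), approxNumber S ((i : ℕ) + 1) ^ q := by
        gcongr with i _
        exact hσa i
    _ ≤ _ := by
        gcongr
        rw [Fin.sum_univ_eq_sum_range (fun i => approxNumber S (i + 1) ^ q)]
        exact ENNReal.sum_le_tsum _

end Hilbert

/-! ### The lower Schatten bound for quasi-geometric sequences. -/

theorem tsum_pow_dist_le {ρ : ℝ} (h0 : 0 ≤ ρ) (h1 : ρ < 1) (n : ℕ) :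
    ∑' k, ENNReal.ofReal (ρ ^ (Nat.dist n k)) ≤ ENNReal.ofReal (2 / (1 - ρ)) := by
  refine ENNReal.tsum_le_of_sum_range_le fun N => ?_
  rw [← ENNReal.ofReal_sum_of_nonneg fun _ _ => by positivity]
  exact ENNReal.ofReal_le_ofReal (sum_pow_dist_le h0 h1 n _)

/-- Truncated subtraction sends all `n < s` to `0`: these `s` terms cost one full sum each, and the
indices `n ≥ s` give one more. -/
theorem tsum_tsub_le (w : ℕ → ℝ≥0∞) (s : ℕ) : ∑' n, w (n - s) ≤ (s + 1 : ℝ≥0∞) * ∑' n, w n := by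
  rw [← ENNReal.summable.sum_add_tsum_nat_add' (f := fun n => w (n - s)) (k := s), add_mul, one_mul]
  simp only [Nat.add_sub_cancel]
  gcongr
  calc ∑ n ∈ Finset.range s, w (n - s) ≤ ∑ n ∈ Finset.range s, ∑' n, w n :=
        Finset.sum_le_sum fun n _ => ENNReal.le_tsum _
    _ = _ := by simp

/-- A matrix with exponential off-diagonal decay acts boundedly on `ℓ^p`. -/
theorem exists_tsum_rpow_le {p : ℝ} (hp : 0 < p) {σ : ℝ} (hσ0 : 0 < σ) (hσ1 : σ < 1) (s : ℕ) :
    ∃ C : ℝ≥0, 0 < C ∧ ∀ W : ℕ → ℝ≥0∞,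
      ∑' n, (∑' k, ENNReal.ofReal (σ ^ (Nat.dist n k)) * W (max n k - s)) ^ p ≤
        C * ∑' n, W n ^ p := by
  -- The decay is split as `σ = τ·τ`: one factor is summed, the other is absorbed in a supremum
  -- bounded by an `ℓ^p` sum. This covers all `p > 0`, including `p < 1`.
  set τ : ℝ := √σ with hτ
  have hτ0 : 0 < τ := Real.sqrt_pos.2 hσ0
  have hτ1 : τ < 1 := (Real.sqrt_lt' one_pos).2 (by simpa using hσ1)
  set θ : ℝ := τ ^ p with hθ
  have hθ0 : 0 < θ := Real.rpow_pos_of_pos hτ0 p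
  have hθ1 : θ < 1 := Real.rpow_lt_one hτ0.le hτ1 hp
  have hτ' : 0 < 1 - τ := by linarith
  have hθ' : 0 < 1 - θ := by linarith
  set K : ℝ≥0∞ := ENNReal.ofReal (2 / (1 - τ)) with hK
  set Θ : ℝ≥0∞ := ENNReal.ofReal (2 / (1 - θ)) with hΘ
  have hK0 : K ≠ 0 := by simpa [hK] using hτ1
  have hΘ0 : Θ ≠ 0 := by simpa [hΘ] using hθ1
  set C : ℝ≥0∞ := K ^ p * (2 * (Θ * (s + 1))) with hC
  have hCtop : C ≠ ∞ := by
    refine ENNReal.mul_ne_top (ENNReal.rpow_ne_top_of_nonneg hp.le ENNReal.ofReal_ne_top) ?_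
    refine ENNReal.mul_ne_top ENNReal.ofNat_ne_top (ENNReal.mul_ne_top ENNReal.ofReal_ne_top ?_)
    exact_mod_cast ENNReal.natCast_ne_top (s + 1)
  have hC0 : C ≠ 0 := by
    refine mul_ne_zero ?_ (mul_ne_zero two_ne_zero (mul_ne_zero hΘ0 (by simp)))
    exact (ENNReal.rpow_pos (pos_iff_ne_zero.2 hK0) ENNReal.ofReal_ne_top).ne'
  refine ⟨C.toNNReal, ENNReal.toNNReal_pos hC0 hCtop, fun W => ?_⟩
  rw [ENNReal.coe_toNNReal hCtop]
  have hrow : ∀ n, (∑' k, ENNReal.ofReal (σ ^ (Nat.dist n k)) * W (max n k - s)) ^ p ≤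
      K ^ p * ∑' k, ENNReal.ofReal (θ ^ (Nat.dist n k)) * W (max n k - s) ^ p := by
    intro n
    set M := ∑' k, ENNReal.ofReal (θ ^ (Nat.dist n k)) * W (max n k - s) ^ p with hM
    have h1 : ∀ k, ENNReal.ofReal (τ ^ (Nat.dist n k)) * W (max n k - s) ≤ M ^ p⁻¹ := by
      intro k
      rw [ENNReal.le_rpow_inv_iff hp, ENNReal.mul_rpow_of_nonneg _ _ hp.le,
        ENNReal.ofReal_rpow_of_nonneg (by positivity) hp.le, ← Real.rpow_pow_comm hτ0.le]
      exact ENNReal.le_tsum k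
    have h2 : ∑' k, ENNReal.ofReal (σ ^ (Nat.dist n k)) * W (max n k - s) ≤ K * M ^ p⁻¹ := by
      calc _ ≤ ∑' k, ENNReal.ofReal (τ ^ (Nat.dist n k)) * M ^ p⁻¹ := by
            refine ENNReal.tsum_le_tsum fun k => ?_
            rw [show σ = τ * τ from (Real.mul_self_sqrt hσ0.le).symm, mul_pow,
              ENNReal.ofReal_mul (by positivity), mul_assoc]
            gcongr
            exact h1 k
        _ = (∑' k, ENNReal.ofReal (τ ^ (Nat.dist n k))) * M ^ p⁻¹ := ENNReal.tsum_mul_right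
        _ ≤ _ := by
            gcongr
            exact tsum_pow_dist_le hτ0.le hτ1 n
    calc _ ≤ (K * M ^ p⁻¹) ^ p := ENNReal.rpow_le_rpow h2 hp.le
      _ = _ := by
          rw [ENNReal.mul_rpow_of_nonneg _ _ hp.le, ← ENNReal.rpow_mul, inv_mul_cancel₀ hp.ne',
            ENNReal.rpow_one]
  set w : ℕ → ℝ≥0∞ := fun n => W n ^ p with hw
  have hhalf : ∑' n, ∑' k, ENNReal.ofReal (θ ^ (Nat.dist n k)) * w (n - s) ≤
      Θ * ((s + 1) * ∑' n, w n) := by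
    calc _ ≤ ∑' n, Θ * w (n - s) := by
          refine ENNReal.tsum_le_tsum fun n => ?_
          rw [ENNReal.tsum_mul_right]
          gcongr
          exact tsum_pow_dist_le hθ0.le hθ1 n
      _ = Θ * ∑' n, w (n - s) := ENNReal.tsum_mul_left
      _ ≤ _ := by
          gcongr
          exact tsum_tsub_le w s
  calc _ ≤ ∑' n, K ^ p * ∑' k, ENNReal.ofReal (θ ^ (Nat.dist n k)) * w (max n k - s) :=
        ENNReal.tsum_le_tsum hrow
    _ = K ^ p * ∑' n, ∑' k, ENNReal.ofReal (θ ^ (Nat.dist n k)) * w (max n k - s) :=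
        ENNReal.tsum_mul_left
    _ ≤ K ^ p * ∑' n, ∑' k, (ENNReal.ofReal (θ ^ (Nat.dist n k)) * w (n - s) +
          ENNReal.ofReal (θ ^ (Nat.dist n k)) * w (k - s)) := by
        gcongr with n k
        rw [← mul_add]
        gcongr
        rcases max_choice n k with h | h <;> rw [h]
        · exact le_self_add
        · exact le_add_self
    _ = K ^ p * (2 * ∑' n, ∑' k, ENNReal.ofReal (θ ^ (Nat.dist n k)) * w (n - s)) := by
        simp only [ENNReal.tsum_add]
        rw [ENNReal.tsum_comm (f := fun n k => ENNReal.ofReal (θ ^ (Nat.dist n k)) * w (k - s)),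
          two_mul]
        simp only [Nat.dist_comm]
    _ ≤ K ^ p * (2 * (Θ * ((s + 1) * ∑' n, w n))) := by gcongr
    _ = _ := by rw [hC]; ring

theorem enorm_smul_monomialLp_sq {Λ : ℕ → ℝ} (hpos : ∀ n, 0 < Λ n) (μ : Measure UnitIco)
    [IsFiniteMeasure μ] (n : ℕ) :
    ‖((√(Λ n) : ℝ) : ℂ) • monomialLp μ (Λ n)‖ₑ ^ 2 =
      ∫⁻ t : UnitIco, ENNReal.ofReal (Λ n * (t : ℝ) ^ (2 * Λ n)) ∂μ := by
  rw [enorm_sq_eq_lintegral]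
  refine lintegral_congr_ae ?_
  filter_upwards [Lp.coeFn_smul ((√(Λ n) : ℝ) : ℂ) (monomialLp μ (Λ n)),
    coeFn_monomialLp μ (hpos n).le] with t h1 h2
  rw [h1, Pi.smul_apply, h2, monomial, smul_eq_mul, ← Complex.ofReal_mul, ← ofReal_norm,
    Complex.norm_real, ← ENNReal.ofReal_pow (norm_nonneg _), Real.norm_eq_abs, sq_abs, mul_pow,
    Real.sq_sqrt (hpos n).le, ← Real.rpow_natCast, ← Real.rpow_mul t.2.1]
  congr 3
  push_cast
  ring

/-- For a quasi-geometric sequence `Dₙ(2)` is controlled by the norms of the normalized monomials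
in `L²(μ)`. -/
theorem exists_D_two_sq_le {Λ : ℕ → ℝ} (hΛ : IsLacunary Λ) (hQ : IsQuasiGeometric Λ) :
    ∃ (σ : ℝ) (s : ℕ) (K : ℝ≥0), 0 < σ ∧ σ < 1 ∧ 0 < K ∧
      ∀ (μ : Measure UnitIco) [IsFiniteMeasure μ] (n : ℕ),
        D Λ μ 2 n ^ 2 ≤ K * ∑' k, ENNReal.ofReal (σ ^ (Nat.dist n k)) *
          ‖((√(Λ (max n k - s)) : ℝ) : ℂ) • monomialLp μ (Λ (max n k - s))‖ₑ ^ 2 := by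
  obtain ⟨hpos, r, R, hr, hrR⟩ := hQ
  have hR1 : 1 ≤ R := hr.le.trans ((hrR 0).1.trans (hrR 0).2)
  have hstep : ∀ n j, Λ (n + j) ≤ R ^ j * Λ n := by
    intro n j
    induction j with
    | zero => simp
    | succ j ih =>
      have h1 := (hrR (n + j)).2
      rw [div_le_iff₀ (hpos _)] at h1
      calc Λ (n + (j + 1)) ≤ R * Λ (n + j) := h1
        _ ≤ R * (R ^ j * Λ n) := by gcongr
        _ = _ := by ring
  obtain ⟨σ, hσ0, hσ1, hσ⟩ := exists_decay hΛ
  -- Going back `s` steps at least halves `Λ`, so `t^(Λₙ+Λₖ)` is bounded by the square of the single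
  -- monomial of index `max n k - s`. If `max n k ≤ s` the truncated index is `0`, and monotonicity
  -- suffices.
  obtain ⟨s, hs⟩ := exists_pow_lt_of_lt_one (by norm_num : (0 : ℝ) < 1 / 2) hσ1
  refine ⟨σ, s, (R ^ s).toNNReal, hσ0, hσ1, Real.toNNReal_pos.2 (by positivity),
    fun μ _ n => ?_⟩
  have hmono := hΛ.monotone
  have hexp : ∀ k, 2 * Λ (max n k - s) ≤ Λ n + Λ k := by
    intro k
    rcases le_total s (max n k) with h | h
    · have h1 := hσ (max n k) (max n k - s) (Nat.sub_le _ _)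
      rw [Nat.sub_sub_self h] at h1
      have h2 : (σ ^ s) ^ 2 ≤ 1 / 2 := by
        have : 0 < σ ^ s := by positivity
        nlinarith
      have h3 : Λ (max n k) ≤ Λ n + Λ k := by
        have := hpos n
        have := hpos k
        rcases max_choice n k with h | h <;> rw [h] <;> linarith
      nlinarith [hpos (max n k)]
    · rw [Nat.sub_eq_zero_of_le h]
      linarith [hmono (Nat.zero_le n), hmono (Nat.zero_le k)]
  have hpt : ∀ (t : UnitIco) k, √(Λ n) * (t : ℝ) ^ Λ n * (√(Λ k) * (t : ℝ) ^ Λ k) ≤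
      R ^ s * (σ ^ (Nat.dist n k) * (Λ (max n k - s) * (t : ℝ) ^ (2 * Λ (max n k - s)))) := by
    intro t k
    have hn := hpos n
    have hk := hpos k
    have hj := hpos (max n k - s)
    -- The upper ratio bound enters here: `R ^ s` pays for lowering the index by `s`.
    have h1 : √(Λ n) * √(Λ k) ≤ σ ^ (Nat.dist n k) * (R ^ s * Λ (max n k - s)) := by
      rw [← Real.sqrt_mul hn.le]
      refine (sqrt_mul_le_pow_dist hpos hσ0 hσ n k).trans ?_
      gcongr
      exact (hmono (by omega)).trans (hstep (max n k - s) s)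
    have h2 : (t : ℝ) ^ (Λ n + Λ k) ≤ (t : ℝ) ^ (2 * Λ (max n k - s)) :=
      Real.rpow_le_rpow_of_exponent_ge' t.2.1 t.2.2.le (by positivity) (hexp k)
    calc _ = √(Λ n) * √(Λ k) * (t : ℝ) ^ (Λ n + Λ k) := by
          rw [Real.rpow_add_of_nonneg t.2.1 hn.le hk.le]; ring
      _ ≤ σ ^ (Nat.dist n k) * (R ^ s * Λ (max n k - s)) * (t : ℝ) ^ (2 * Λ (max n k - s)) :=
          mul_le_mul h1 h2 (Real.rpow_nonneg t.2.1 _) (by positivity)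
      _ = _ := by ring
  have hm : ∀ a c : ℝ, Measurable fun t : UnitIco => ENNReal.ofReal (c * (t : ℝ) ^ a) :=
    measurable_normalized
  rw [D_two_sq]
  calc _ = ∫⁻ t : UnitIco, ∑' k, ENNReal.ofReal (√(Λ n) * (t : ℝ) ^ Λ n) *
          ENNReal.ofReal (√(Λ k) * (t : ℝ) ^ Λ k) ∂μ := by simp only [ENNReal.tsum_mul_left]
    _ = ∑' k, ∫⁻ t : UnitIco, ENNReal.ofReal (√(Λ n) * (t : ℝ) ^ Λ n) *
          ENNReal.ofReal (√(Λ k) * (t : ℝ) ^ Λ k) ∂μ :=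
        lintegral_tsum fun k => ((hm _ _).mul (hm _ _)).aemeasurable
    _ ≤ ∑' k, ENNReal.ofReal (R ^ s) * (ENNReal.ofReal (σ ^ (Nat.dist n k)) *
          ‖((√(Λ (max n k - s)) : ℝ) : ℂ) • monomialLp μ (Λ (max n k - s))‖ₑ ^ 2) := by
        refine ENNReal.tsum_le_tsum fun k => ?_
        rw [enorm_smul_monomialLp_sq hpos, ← lintegral_const_mul _ (hm _ _),
          ← lintegral_const_mul _ ((hm _ _).const_mul _)]
        refine lintegral_mono fun t => ?_
        rw [← ENNReal.ofReal_mul (mul_nonneg (Real.sqrt_nonneg _) (Real.rpow_nonneg t.2.1 _)),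
          ← ENNReal.ofReal_mul (by positivity), ← ENNReal.ofReal_mul (by positivity)]
        exact ENNReal.ofReal_le_ofReal (hpt t k)
    _ = _ := ENNReal.tsum_mul_left

theorem tsum_enorm_rpow_le {Λ : ℕ → ℝ} (hΛ : IsLacunary Λ) {q : ℝ} (hq : 2 ≤ q) :
    ∃ B : ℝ≥0, 0 < B ∧ ∀ (μ : Measure UnitIco) [IsFiniteMeasure μ], IsCarleson Λ μ →
      ∑' n, ‖((√(Λ n) : ℝ) : ℂ) • monomialLp μ (Λ n)‖ₑ ^ q ≤
        B * ∑' i : ℕ, approxNumber (carlesonEmbedding Λ μ) (i + 1) ^ q := by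
  obtain ⟨B, hB, h⟩ := exists_bessel hΛ
  refine ⟨B.toNNReal, Real.toNNReal_pos.2 hB, fun μ _ hμ => ?_⟩
  have hpos := hΛ.1
  set g : ℕ → muntzSpace Λ := fun n =>
    ((√(Λ n) : ℝ) : ℂ) • polynomialMuntz Λ (Finsupp.single n 1) with hg
  have hsingle : ∀ (ν : Measure UnitIco) n,
      polynomialLp Λ ν (Finsupp.single n 1) = monomialLp ν (Λ n) := fun ν n => by
    rw [polynomialLp, Finsupp.linearCombination_single, one_smul]
  have hgv : ∀ n, (g n : Lp ℂ 2 lebesgue) = ((√(Λ n) : ℝ) : ℂ) • monomialLp lebesgue (Λ n) :=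
    fun n => by rw [← hsingle]; rfl
  have hSg : ∀ n, carlesonEmbedding Λ μ (g n) = ((√(Λ n) : ℝ) : ℂ) • monomialLp μ (Λ n) := by
    intro n
    rw [hg, map_smul, carlesonEmbedding_polynomial hμ, hsingle]
  have hg1 : ∀ n, ‖g n‖ ≤ 1 := by
    intro n
    have hn := hpos n
    have h1 : ‖monomialLp lebesgue (Λ n)‖ ^ 2 = 1 / (2 * Λ n + 1) := by
      have h2 := inner_monomialLp_lebesgue hn.le hn.le
      rw [inner_self_eq_norm_sq_to_K] at h2
      have h3 : ‖monomialLp lebesgue (Λ n)‖ ^ 2 = 1 / ((Λ n + 1 / 2) + (Λ n + 1 / 2)) := by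
        refine Complex.ofReal_injective ?_
        rw [Complex.ofReal_div, Complex.ofReal_one, ← h2, Complex.ofReal_pow]
        rfl
      rw [h3]
      congr 1
      ring
    have h4 : ‖g n‖ ^ 2 ≤ 1 := by
      rw [show ‖g n‖ = ‖(g n : Lp ℂ 2 lebesgue)‖ from rfl, hgv, norm_smul, mul_pow, h1,
        Complex.norm_real, Real.norm_eq_abs, sq_abs, Real.sq_sqrt hn.le, mul_one_div,
        div_le_one (by positivity)]
      linarith
    exact (sq_le_one_iff₀ (norm_nonneg _)).1 h4
  refine ENNReal.tsum_le_of_sum_range_le fun N => ?_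
  simp only [← hSg]
  refine sum_enorm_rpow_le_tsum_approxNumber _ hq g hg1 _ fun f => ?_
  refine le_of_eq_of_le (Finset.sum_congr rfl fun n _ => ?_) (h (Finset.range N) f)
  rw [Submodule.coe_inner, hgv, inner_smul_left, norm_mul, RCLike.norm_conj, mul_pow,
    Complex.norm_real, Real.norm_eq_abs, sq_abs, Real.sq_sqrt (hpos n).le]

theorem ellNorm_le_schattenNorm {Λ : ℕ → ℝ} (hΛ : IsLacunary Λ) (hQ : IsQuasiGeometric Λ) {q : ℝ}
    (hq : 2 ≤ q) :
    ∃ c : ℝ≥0, 0 < c ∧ ∀ (μ : Measure UnitIco) [IsFiniteMeasure μ], IsCarleson Λ μ →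
      c * ellNorm q (D Λ μ 2) ≤ schattenNorm q (carlesonEmbedding Λ μ) := by
  have hq0 : 0 < q := by linarith
  have hp : 0 < q / 2 := by positivity
  obtain ⟨σ, s, K, hσ0, hσ1, hK, hD⟩ := exists_D_two_sq_le hΛ hQ
  obtain ⟨C, hC, hconv⟩ := exists_tsum_rpow_le hp hσ0 hσ1 s
  obtain ⟨B, hB, hS⟩ := tsum_enorm_rpow_le hΛ hq
  have hhalf : ∀ x : ℝ≥0∞, (x ^ 2) ^ (q / 2) = x ^ q := fun x => by
    rw [← ENNReal.rpow_natCast, ← ENNReal.rpow_mul]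
    congr 1
    push_cast
    ring
  -- The three factors come from the pointwise kernel bound, the action on `ℓ^{q/2}` and the Bessel
  -- estimate.
  set E : ℝ≥0 := K ^ (q / 2) * (C * B) with hE
  have hE0 : 0 < E := mul_pos (NNReal.rpow_pos hK) (mul_pos hC hB)
  refine ⟨(E ^ (1 / q))⁻¹, inv_pos.2 (NNReal.rpow_pos hE0), fun μ _ hμ => ?_⟩
  have hmain : ∑' n, D Λ μ 2 n ^ q ≤
      E * ∑' i : ℕ, approxNumber (carlesonEmbedding Λ μ) (i + 1) ^ q := by
    set W : ℕ → ℝ≥0∞ := fun n => ‖((√(Λ n) : ℝ) : ℂ) • monomialLp μ (Λ n)‖ₑ ^ 2 with hW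
    calc _ = ∑' n, (D Λ μ 2 n ^ 2) ^ (q / 2) := by simp only [hhalf]
      _ ≤ ∑' n, (K : ℝ≥0∞) ^ (q / 2) *
          (∑' k, ENNReal.ofReal (σ ^ (Nat.dist n k)) * W (max n k - s)) ^ (q / 2) := by
          refine ENNReal.tsum_le_tsum fun n => ?_
          rw [← ENNReal.mul_rpow_of_nonneg _ _ hp.le]
          exact ENNReal.rpow_le_rpow (hD μ n) hp.le
      _ = (K : ℝ≥0∞) ^ (q / 2) *
          ∑' n, (∑' k, ENNReal.ofReal (σ ^ (Nat.dist n k)) * W (max n k - s)) ^ (q / 2) :=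
          ENNReal.tsum_mul_left
      _ ≤ (K : ℝ≥0∞) ^ (q / 2) * (C * ∑' n, W n ^ (q / 2)) := by
          gcongr
          exact hconv W
      _ ≤ (K : ℝ≥0∞) ^ (q / 2) *
          (C * (B * ∑' i : ℕ, approxNumber (carlesonEmbedding Λ μ) (i + 1) ^ q)) := by
          gcongr
          simp only [hW, hhalf]
          exact hS μ hμ
      _ = _ := by
          rw [hE, ENNReal.coe_mul, ENNReal.coe_mul, ENNReal.coe_rpow_of_nonneg _ hp.le]
          ring
  have hq' : 0 ≤ 1 / q := by positivity
  have h2 := ENNReal.rpow_le_rpow hmain hq'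
  rw [ENNReal.mul_rpow_of_nonneg _ _ hq', ← ENNReal.coe_rpow_of_nonneg _ hq'] at h2
  have hne : (E ^ (1 / q) : ℝ≥0) ≠ 0 := (NNReal.rpow_pos hE0).ne'
  rw [ENNReal.coe_inv hne, mul_comm, ← div_eq_mul_inv]
  exact ENNReal.div_le_of_le_mul' h2

end Muntz

end

theorem mainTheorem10 (Λ : ℕ → ℝ) (hΛ : Muntz.IsLacunary Λ) (q : ℝ) (hq : 0 < q) :
    (∃ C : ℝ≥0, 0 < C ∧ ∀ (μ : Measure Muntz.UnitIco) [IsFiniteMeasure μ],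
      Muntz.ellNorm q (Muntz.D Λ μ 2) < ∞ →
        Muntz.IsCarleson Λ μ ∧ Muntz.MemSchatten q (Muntz.carlesonEmbedding Λ μ) ∧
          Muntz.schattenNorm q (Muntz.carlesonEmbedding Λ μ) ≤
            C * Muntz.ellNorm q (Muntz.D Λ μ 2)) ∧
    (Muntz.IsQuasiGeometric Λ → 2 ≤ q →
      ∃ c C : ℝ≥0, 0 < c ∧ 0 < C ∧ ∀ (μ : Measure Muntz.UnitIco) [IsFiniteMeasure μ],
        Muntz.IsCarleson Λ μ →
          c * Muntz.ellNorm q (Muntz.D Λ μ 2) ≤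
              Muntz.schattenNorm q (Muntz.carlesonEmbedding Λ μ) ∧
            Muntz.schattenNorm q (Muntz.carlesonEmbedding Λ μ) ≤
              C * Muntz.ellNorm q (Muntz.D Λ μ 2)) := by
  have upper := Muntz.memSchatten_and_schattenNorm_le hΛ hq
  refine ⟨upper, fun hQ hq2 => ?_⟩
  obtain ⟨C, hC, hup⟩ := upper
  obtain ⟨c, hc, hlow⟩ := Muntz.ellNorm_le_schattenNorm hΛ hQ hq2
  refine ⟨c, C, hc, hC, fun μ _ hμ => ⟨hlow μ hμ, ?_⟩⟩
  -- When the right side is infinite the bound is trivial, because `C > 0` gives `C * ∞ = ∞`.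
  rcases eq_or_ne (Muntz.ellNorm q (Muntz.D Λ μ 2)) ∞ with h | h
  · rw [h, ENNReal.mul_top (by exact_mod_cast hC.ne')]
    exact le_top
  · exact (hup μ h.lt_top).2.2
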